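/- **Proposition 1.1.** Let $s>3/2$. There is a constant $C>0$, depending only on $s$, such that the following holds for every $1<\alpha\le 2$ and every divergence-free real vector field $u_{0,\alpha}\in H^s(\mathbb{R}^3)$ (with three components). If $u_{0,\alpha}\neq 0$, put $$T_\alpha=\frac12\left(\frac{1-\frac1\alpha}{4C\,\|u_{0,\alpha}\|_{H^s}}\right)^{\frac{\alpha}{\alpha-1}};$$ then $0<T_\alpha<\infty$. If $u_{0,\alpha}=0$, let $T_\alpha>0$ be arbitrary. Then there is a unique real vector field $u_\alpha\in C([0,T_\alpha],H^s(\mathbb{R}^3))$ that is a mild solution on $[0,T_\alpha]$ of the (fractional) Navier-Stokes equations $$\partial_t u_\alpha=-(-\Delta)^{\alpha/2}u_\alpha-(u_\alpha\cdot\nabla)u_\alpha-\nabla p_\alpha,\qquad \operatorname{div}u_\alpha=0,\qquad u_\alpha(0,\cdot)=u_{0,\alpha},$$ that is, which satisfies for all $t\in[0,T_\alpha]$ $$u_\alpha(t)=e^{-t(-\Delta)^{\alpha/2}}u_{0,\alpha}-\int_0^t e^{-(t-\tau)(-\Delta)^{\alpha/2}}\,\mathbb{P}\big((u_\alpha\cdot\nabla)u_\alpha\big)(\tau)\,d\tau$$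 with an absolutely convergent integral in $L^2(\mathbb{R}^3)$. Here $e^{-t(-\Delta)^{\alpha/2}}$ is the Fourier multiplier with symbol $e^{-t|\xi|^\alpha}$ and $\mathbb{P}$ is Leray's projector, the Fourier multiplier with matrix symbol $\delta_{ij}-\xi_i\xi_j/|\xi|^2$. Uniqueness holds among all real mild solutions in $C([0,T_\alpha],H^s(\mathbb{R}^3))$. Moreover $\operatorname{div}u_\alpha(t)=0$ for all $t\in[0,T_\alpha]$, and the associated pressure, given by $$p_\alpha=\sum_{i,j=1}^3\mathcal{R}_i\mathcal{R}_j(u_{\alpha,i}\,u_{\alpha,j}),\qquad \mathcal{R}_i=\frac{\partial_i}{\sqrt{-\Delta}},$$ is real-valued and belongs to $C([0,T_\alpha],H^s(\mathbb{R}^3))$. -/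

import Mathlib

open MeasureTheory Set Filter Topology FourierTransform
open scoped ENNReal SchwartzMap LineDeriv

noncomputable section

namespace FracNS

/-- Physical (and frequency) space `ℝ³` with its Euclidean norm. -/
abbrev E3 : Type := EuclideanSpace ℝ (Fin 3)

/-- Real-valued square integrable functions on `ℝ³` (almost everywhere classes). -/
abbrev L2R : Type := Lp ℝ 2 (volume : Measure E3)

/-- Complex-valued square integrable functions on `ℝ³` (almost everywhere classes). -/
abbrev L2C : Type := Lp ℂ 2 (volume : Measure E3)

/-- A real-valued `L²` function regarded as a complex-valued one. -/
def toC (f : L2R) : L2C := Complex.ofRealCLM.compLp f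

/-- The Fourier multiplier `f ↦ 𝓕⁻¹ (m · 𝓕 f)` on `L²(ℝ³)`, with its maximal domain
`{f | m · 𝓕 f ∈ L²}`; the value outside the domain is `0`. Here `𝓕` is the unitary Fourier
transform with kernel `exp (-2πi x·ξ)`, so `∂ⱼ` has the symbol `2πi ξⱼ` and `-Δ` has the symbol
`(2π|ξ|)²`. -/
def fourierMul (m : E3 → ℂ) (f : L2C) : L2C :=
  open Classical in
  if h : MemLp (fun ξ : E3 => m ξ * (𝓕 f : L2C) ξ) 2 volume then 𝓕⁻ (h.toLp _ : L2C) else 0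

/-- The pointwise product of two functions, when it is in `L²` (and `0` otherwise). -/
def mulL2 (f g : L2C) : L2C :=
  open Classical in
  if h : MemLp (fun x : E3 => f x * g x) 2 volume then h.toLp _ else 0

/-- The (weak) partial derivative `∂ⱼ f`, for `f ∈ L²` with `∂ⱼ f ∈ L²`. -/
def partialD (j : Fin 3) (f : L2C) : L2C :=
  fourierMul (fun ξ => 2 * Real.pi * Complex.I * (ξ j : ℂ)) f

/-- The fractional heat semigroup `exp (-t (-Δ)^(α/2))`, `t ≥ 0`. -/
def heatSemigroup (α t : ℝ) (f : L2C) : L2C :=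
  fourierMul (fun ξ => (Real.exp (-t * (2 * Real.pi * ‖ξ‖) ^ α) : ℂ)) f

/-- The Riesz transform `Rⱼ = ∂ⱼ (-Δ)^(-1/2)`, with symbol `i ξⱼ / |ξ|`. -/
def riesz (j : Fin 3) (f : L2C) : L2C :=
  fourierMul (fun ξ => Complex.I * (ξ j : ℂ) / (‖ξ‖ : ℂ)) f

/-- The Leray projector `ℙ`, `(ℙ f)ᵢ = fᵢ + ∑ⱼ Rᵢ Rⱼ fⱼ`; its symbol is the matrix
`δᵢⱼ - ξᵢ ξⱼ / |ξ|²`. -/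
def leray (f : Fin 3 → L2C) (i : Fin 3) : L2C :=
  f i + ∑ j, riesz i (riesz j (f j))

/-- The convection term `((u · ∇) u)ᵢ = ∑ⱼ uⱼ ∂ⱼ uᵢ`. -/
def convection (u : Fin 3 → L2R) (i : Fin 3) : L2C :=
  ∑ j, mulL2 (toC (u j)) (partialD j (toC (u i)))

/-- `div u = 0`. -/
def DivFree (u : Fin 3 → L2R) : Prop :=
  ∑ j, partialD j (toC (u j)) = 0

/-- Membership in the Sobolev space `H^s(ℝ³)` (real-valued functions, `s ≥ 0`). -/
def MemHs (s : ℝ) (f : L2R) : Prop :=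
  TemperedDistribution.MemSobolev s 2 (toC f : 𝓢'(E3, ℂ))

/-- The norm of `H^s(ℝ³)`, `‖f‖ = ‖(1 - Δ)^(s/2) f‖_{L²} = ‖(1 + |2πξ|²)^(s/2) 𝓕 f‖_{L²}`, as an
extended nonnegative number. -/
def hsENorm (s : ℝ) (f : L2R) : ℝ≥0∞ :=
  eLpNorm (fun ξ : E3 => (((1 + (2 * Real.pi * ‖ξ‖) ^ 2) ^ (s / 2) : ℝ) : ℂ) *
    (𝓕 (toC f) : L2C) ξ) 2 volume

/-- The norm of a vector field in `H^s(ℝ³)`. -/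
def hsNorm (s : ℝ) (u : Fin 3 → L2R) : ℝ :=
  Real.sqrt (∑ i, (hsENorm s (u i)).toReal ^ 2)

/-- `f ∈ C([0,T], H^s(ℝ³))`. -/
def ContHs (s T : ℝ) (f : ℝ → L2R) : Prop :=
  (∀ t ∈ Icc 0 T, MemHs s (f t)) ∧
    ∀ t₀ ∈ Icc 0 T, Tendsto (fun t => hsENorm s (f t - f t₀)) (𝓝[Icc 0 T] t₀) (𝓝 0)

/-- `u` is a mild solution on `[0,T]` of the (fractional) Navier-Stokes equations with initial
datum `u₀`: the Duhamel formula
`u(t) = e^{-t(-Δ)^{α/2}} u₀ - ∫₀ᵗ e^{-(t-τ)(-Δ)^{α/2}} ℙ((u·∇)u)(τ) dτ`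
holds for all `t ∈ [0,T]`, with an absolutely convergent (Bochner) integral. -/
def IsMildSolution (α T : ℝ) (u₀ : Fin 3 → L2R) (u : ℝ → Fin 3 → L2R) : Prop :=
  ∀ t ∈ Icc 0 T, ∀ i,
    IntervalIntegrable (fun τ => heatSemigroup α (t - τ) (leray (convection (u τ)) i))
      volume 0 t ∧
    toC (u t i) = heatSemigroup α t (toC (u₀ i)) -
      ∫ τ in (0 : ℝ)..t, heatSemigroup α (t - τ) (leray (convection (u τ)) i)

/-- `p` is the pressure associated with the velocity `u` at a fixed time:
`p = ∑ᵢⱼ Rᵢ Rⱼ (uᵢ uⱼ)`. -/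
def IsPressure (u : Fin 3 → L2R) (p : L2R) : Prop :=
  toC p = ∑ i, ∑ j, riesz i (riesz j (mulL2 (toC (u i)) (toC (u j))))

/-- The existence time `½ ((1 - 1/α) / (4 C ‖u₀‖_{H^s}))^(α/(α-1))`, for `u₀ ≠ 0`. -/
def existenceTime (C s α : ℝ) (u₀ : Fin 3 → L2R) : ℝ :=
  1 / 2 * ((1 - 1 / α) / (4 * C * hsNorm s u₀)) ^ (α / (α - 1))


/-- Multiplication of an `L²` function, as a tempered distribution, by a function of temperate
growth is pointwise multiplication. -/
theorem smulLeftCLM_eq_iff {w : E3 → ℂ} (hw : w.HasTemperateGrowth) (g g' : L2C) :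
    TemperedDistribution.smulLeftCLM ℂ w (g : 𝓢'(E3, ℂ)) = (g' : 𝓢'(E3, ℂ)) ↔
      (fun x => w x * g x) =ᵐ[volume] g' := by
  have hgl : LocallyIntegrable (fun x => g x) (volume : Measure E3) :=
    (Lp.memLp g).locallyIntegrable one_le_two
  have hgl' : LocallyIntegrable (fun x => g' x) (volume : Measure E3) :=
    (Lp.memLp g').locallyIntegrable one_le_two
  have hwl : LocallyIntegrable (fun x => w x * g x) (volume : Measure E3) := by
    have h := hgl.locallyIntegrableOn univ
    rw [← locallyIntegrableOn_univ]
    exact h.continuousOn_mul hw.1.continuous.continuousOn isOpen_univ.isLocallyClosed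
  constructor
  · intro h
    have key : ∀ᵐ x ∂(volume : Measure E3), w x * g x - g' x = 0 := by
      apply ae_eq_zero_of_integral_contDiff_smul_eq_zero (hwl.sub hgl')
      intro φ hφ hc
      have hg₁ : HasCompactSupport (Complex.ofRealCLM ∘ φ) := hc.comp_left rfl
      have hg₂ : ContDiff ℝ (⊤ : ℕ∞) (Complex.ofRealCLM ∘ φ) := by fun_prop
      have h2 := DFunLike.congr_fun h (hg₁.toSchwartzMap hg₂)
      simp only [TemperedDistribution.smulLeftCLM_apply_apply, Lp.toTemperedDistribution_apply,
        SchwartzMap.smulLeftCLM_apply_apply hw] at h2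
      have i1 : Integrable (fun x => φ x • (w x * g x)) (volume : Measure E3) :=
        hwl.integrable_smul_left_of_hasCompactSupport hφ.continuous hc
      have i2 : Integrable (fun x => φ x • g' x) (volume : Measure E3) :=
        hgl'.integrable_smul_left_of_hasCompactSupport hφ.continuous hc
      have : ∀ x, φ x • ((fun x => w x * g x) - fun x => g' x) x
          = φ x • (w x * g x) - φ x • g' x := fun x => smul_sub _ _ _
      simp_rw [this]
      rw [integral_sub i1 i2, sub_eq_zero]
      refine Eq.trans ?_ (h2.trans ?_)
      · refine integral_congr_ae (Filter.Eventually.of_forall fun x => ?_)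
        have hx : (hg₁.toSchwartzMap hg₂) x = (φ x : ℂ) := by simp
        simp only [hx, smul_eq_mul, Complex.real_smul]
        ring
      · refine integral_congr_ae (Filter.Eventually.of_forall fun x => ?_)
        simp
    filter_upwards [key] with x hx using sub_eq_zero.mp hx
  · intro h
    ext u
    simp only [TemperedDistribution.smulLeftCLM_apply_apply, Lp.toTemperedDistribution_apply,
      SchwartzMap.smulLeftCLM_apply_apply hw]
    apply integral_congr_ae
    filter_upwards [h] with x hx
    simp only [smul_eq_mul, ← hx]
    ring

/-- For `s ≥ 0` the Sobolev norm is finite exactly on the Sobolev space. -/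
theorem memHs_iff {s : ℝ} (hs : 0 ≤ s) (f : L2R) : MemHs s f ↔ hsENorm s f < ∞ := by
  have hw : (fun x : E3 => (((1 + ‖x‖ ^ 2) ^ (s / 2) : ℝ) : ℂ)).HasTemperateGrowth := by fun_prop
  have meas : ∀ c : ℝ, AEStronglyMeasurable (fun ξ : E3 =>
      (((1 + (c * ‖ξ‖) ^ 2) ^ (s / 2) : ℝ) : ℂ) * (𝓕 (toC f) : L2C) ξ) volume := by
    intro c
    have : Continuous fun ξ : E3 => (((1 + (c * ‖ξ‖) ^ 2) ^ (s / 2) : ℝ) : ℂ) := by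
      refine Complex.continuous_ofReal.comp (Continuous.rpow_const (by fun_prop) ?_)
      intro x; left; positivity
    exact this.aestronglyMeasurable.mul (Lp.aestronglyMeasurable _)
  have h1 : MemHs s f ↔ MemLp (fun ξ : E3 =>
      (((1 + (1 * ‖ξ‖) ^ 2) ^ (s / 2) : ℝ) : ℂ) * (𝓕 (toC f) : L2C) ξ) 2 volume := by
    simp only [one_mul]
    rw [MemHs, TemperedDistribution.memSobolev_iff_exists_smulLeftCLM_fourier]
    constructor
    · rintro ⟨f', hf'⟩
      rw [Lp.fourier_toTemperedDistribution_eq, smulLeftCLM_eq_iff hw] at hf'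
      exact (memLp_congr_ae hf').mpr (Lp.memLp f')
    · intro h
      refine ⟨h.toLp _, ?_⟩
      rw [Lp.fourier_toTemperedDistribution_eq, smulLeftCLM_eq_iff hw]
      exact h.coeFn_toLp.symm
  have hpi : 1 ≤ 2 * Real.pi := by linarith [Real.pi_gt_three]
  rw [h1, hsENorm]
  constructor
  · intro h
    refine (h.of_le_mul (c := ((2 * Real.pi) ^ 2) ^ (s / 2)) (meas (2 * Real.pi)) ?_).2
    refine Filter.Eventually.of_forall fun ξ => ?_
    rw [norm_mul, norm_mul, ← mul_assoc, Complex.norm_real, Complex.norm_real,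
      Real.norm_of_nonneg (by positivity), Real.norm_of_nonneg (by positivity),
      ← Real.mul_rpow (by positivity) (by positivity)]
    gcongr
    nlinarith [sq_nonneg ‖ξ‖]
  · intro h
    have h' : MemLp _ 2 volume := ⟨meas (2 * Real.pi), h⟩
    refine h'.mono (meas 1) (Filter.Eventually.of_forall fun ξ => ?_)
    rw [norm_mul, norm_mul, Complex.norm_real, Complex.norm_real,
      Real.norm_of_nonneg (by positivity), Real.norm_of_nonneg (by positivity)]
    gcongr

theorem fourierMul_coe {m : E3 → ℂ} (hm : m.HasTemperateGrowth) (f : L2C)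
    (h : MemLp (fun ξ : E3 => m ξ * (𝓕 f : L2C) ξ) 2 volume) :
    ((fourierMul m f : L2C) : 𝓢'(E3, ℂ)) =
      TemperedDistribution.fourierMultiplierCLM ℂ m (f : 𝓢'(E3, ℂ)) := by
  rw [fourierMul, dif_pos h, TemperedDistribution.fourierMultiplierCLM_apply,
    Lp.fourier_toTemperedDistribution_eq, (smulLeftCLM_eq_iff hm _ _).mpr h.coeFn_toLp.symm,
    Lp.fourierInv_toTemperedDistribution_eq]

/-- On its domain, `partialD j` is the distributional derivative. -/
theorem partialD_coe (j : Fin 3) (f : L2C)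
    (h : MemLp (fun ξ : E3 => 2 * Real.pi * Complex.I * (ξ j : ℂ) * (𝓕 f : L2C) ξ) 2 volume) :
    ((partialD j f : L2C) : 𝓢'(E3, ℂ)) =
      ∂_{(EuclideanSpace.single j 1 : E3)} (f : 𝓢'(E3, ℂ)) := by
  have hm : (fun ξ : E3 =>
      ((inner ℝ ξ (EuclideanSpace.single j (1 : ℝ)) : ℝ) : ℂ)).HasTemperateGrowth := by fun_prop
  have e : (fun ξ : E3 => 2 * Real.pi * Complex.I * (ξ j : ℂ)) =
      (2 * Real.pi * Complex.I) • fun ξ : E3 =>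
        ((inner ℝ ξ (EuclideanSpace.single j (1 : ℝ)) : ℝ) : ℂ) := by
    ext ξ
    simp [EuclideanSpace.inner_single_right]
  have hm' : (fun ξ : E3 => 2 * Real.pi * Complex.I * (ξ j : ℂ)).HasTemperateGrowth := by
    rw [e]
    exact (Function.HasTemperateGrowth.const _).mul hm
  rw [TemperedDistribution.lineDeriv_eq_fourierMultiplierCLM, partialD, fourierMul_coe hm' f h, e,
    TemperedDistribution.fourierMultiplierCLM_smul hm]
  rfl

end FracNS

end

open FracNS

/-!
The proof lives on the Fourier side. A function in `H^s` is written as `(1 - Δ)^(-s/2) 𝓕⁻¹ g` with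
`g` in `L²` (`ofRep`), so that `C([0,T], H^s)` becomes `C([0,T], L²)` and all the linear operators
become multiplications by bounded symbols (`mulL`), which commute.

For `s > 3/2` the Fourier transform of an `H^s` function is integrable, products turn into
convolutions (`mulL2_fourierInv`), and Peetre's inequality together with Young's inequality
`L¹ * L² ⊆ L²` makes `H^s` an algebra (`norm_prodHs_le`). If `div u = 0`, then
`(u · ∇) u = div (u ⊗ u)` (`fourier_convection`), and the derivative can be put on the semigroup:
`e^{-r(-Δ)^{α/2}} ℙ div` has norm at most `12 r^{-1/α}` on `H^s` (`isSingularKernel_duhamelKernel`).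
As `α > 1`, this singularity is integrable, and Duhamel's formula is a Volterra equation with a
weakly singular kernel and a quadratic nonlinearity (`isMildSolution_iff`).

Such an equation is solved by contraction in the ball of twice the radius of the data
(`IsSingularKernel.exists_solution`); the existence time in the theorem is the one for which this is
a contraction. Continuous solutions of any size are unique (`IsSingularKernel.solution_unique`),
since an exponential weight in time makes the equation for the difference of two of them contractive.
A competing mild solution is not assumed to be divergence free, but the Leray projector makes it
so (`divL_eq_zero_of_isMildSolution`), which brings it under the same Volterra equation. Uniqueness
also gives that the solution is real: the complex conjugate field solves the same equation
(`exists_real_solution`). The pressure belongs to `C([0,T], H^s)` by the algebra property.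
-/

noncomputable section

namespace FracNS

/-! ### Bounded multiplication operators on `L²` -/

/-- Multiplication by `m` as a bounded operator on `L²(ℝ³)`; it is the zero operator unless `m` is
essentially bounded. -/
def mulL (m : E3 → ℂ) : L2C →L[ℂ] L2C :=
  open Classical in
  if h : MemLp m ∞ volume then (ContinuousLinearMap.mul ℂ ℂ).holderL volume ∞ 2 2 (h.toLp m) else 0

theorem mulL_coeFn {m : E3 → ℂ} (hm : MemLp m ∞ volume) (f : L2C) :
    mulL m f =ᵐ[volume] fun ξ => m ξ * f ξ := by
  rw [mulL, dif_pos hm]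
  refine ((ContinuousLinearMap.mul ℂ ℂ).coeFn_holder (hm.toLp m) f).trans ?_
  filter_upwards [hm.coeFn_toLp] with ξ hξ
  simp [hξ]

theorem eq_mulL {m : E3 → ℂ} (hm : MemLp m ∞ volume) {f g : L2C}
    (h : g =ᵐ[volume] fun ξ => m ξ * f ξ) : g = mulL m f :=
  Lp.ext (h.trans (mulL_coeFn hm f).symm)

theorem norm_mulL_le {m : E3 → ℂ} (hm : MemLp m ∞ volume) {c : ℝ} (hc : ∀ ξ, ‖m ξ‖ ≤ c)
    (f : L2C) : ‖mulL m f‖ ≤ c * ‖f‖ := by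
  refine Lp.norm_le_mul_norm_of_ae_le_mul ?_
  filter_upwards [mulL_coeFn hm f] with ξ hξ
  rw [hξ, norm_mul]
  gcongr
  exact hc ξ

theorem memLp_mul {m m' : E3 → ℂ} (hm : MemLp m ∞ volume) (hm' : MemLp m' ∞ volume) :
    MemLp (fun ξ => m ξ * m' ξ) ∞ (volume : Measure E3) :=
  hm'.mul hm

theorem mulL_mulL {m m' : E3 → ℂ} (hm : MemLp m ∞ volume) (hm' : MemLp m' ∞ volume) (f : L2C) :
    mulL m (mulL m' f) = mulL (fun ξ => m ξ * m' ξ) f := by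
  refine eq_mulL (memLp_mul hm hm') ?_
  filter_upwards [mulL_coeFn hm (mulL m' f), mulL_coeFn hm' f] with ξ h1 h2
  rw [h1, h2, mul_assoc]

theorem mulL_comm {m m' : E3 → ℂ} (hm : MemLp m ∞ volume) (hm' : MemLp m' ∞ volume) (f : L2C) :
    mulL m (mulL m' f) = mulL m' (mulL m f) := by
  rw [mulL_mulL hm hm', mulL_mulL hm' hm]
  simp_rw [mul_comm]

theorem mulL_injective {m : E3 → ℂ} (hm : MemLp m ∞ volume) (h0 : ∀ ξ, m ξ ≠ 0) :
    Function.Injective (mulL m) := by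
  intro f g h
  refine Lp.ext ?_
  filter_upwards [mulL_coeFn hm f, mulL_coeFn hm g] with ξ h1 h2
  rw [h, h2] at h1
  exact (mul_left_cancel₀ (h0 ξ) h1).symm

theorem fourierMul_eq {m : E3 → ℂ} (hm : MemLp m ∞ volume) (f : L2C) :
    fourierMul m f = 𝓕⁻ (mulL m (𝓕 f)) := by
  have h : MemLp (fun ξ : E3 => m ξ * (𝓕 f : L2C) ξ) 2 volume :=
    (memLp_congr_ae (mulL_coeFn hm (𝓕 f))).mp (Lp.memLp _)
  rw [fourierMul, dif_pos h]
  congr 1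
  exact eq_mulL hm h.coeFn_toLp

theorem fourier_fourierMul {m : E3 → ℂ} (hm : MemLp m ∞ volume) (f : L2C) :
    𝓕 (fourierMul m f) = mulL m (𝓕 f) := by
  rw [fourierMul_eq hm, FourierTransform.fourier_fourierInv_eq]

theorem eLpNorm_two_eq {β : Type*} [NormedAddCommGroup β] (f : E3 → β) :
    eLpNorm f 2 volume = (∫⁻ ξ, ‖f ξ‖ₑ ^ 2) ^ (1 / 2 : ℝ) := by
  rw [eLpNorm_eq_lintegral_rpow_enorm_toReal (by norm_num) (by norm_num)]
  simp

/-- Multiplication operators depend strongly continuously on a boundedly, pointwise convergent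
symbol. -/
theorem tendsto_mulL {ι : Type*} {l : Filter ι} [l.IsCountablyGenerated] {m : ι → E3 → ℂ}
    {m₀ : E3 → ℂ} {c : ℝ} (hm : ∀ᶠ i in l, MemLp (m i) ∞ volume) (hm₀ : MemLp m₀ ∞ volume)
    (hc : ∀ᶠ i in l, ∀ ξ, ‖m i ξ‖ ≤ c) (hc₀ : ∀ ξ, ‖m₀ ξ‖ ≤ c)
    (h : ∀ ξ, Tendsto (fun i => m i ξ) l (𝓝 (m₀ ξ))) (f : L2C) :
    Tendsto (fun i => mulL (m i) f) l (𝓝 (mulL m₀ f)) := by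
  rw [Lp.tendsto_Lp_iff_tendsto_eLpNorm']
  have key : Tendsto (fun i => ∫⁻ ξ, ‖(m i ξ - m₀ ξ) * f ξ‖ₑ ^ 2) l (𝓝 (∫⁻ _ : E3, 0)) := by
    refine tendsto_lintegral_filter_of_dominated_convergence'
      (fun ξ => (ENNReal.ofReal (c + c) * ‖f ξ‖ₑ) ^ 2) ?_ ?_ ?_ ?_
    · filter_upwards [hm] with i hi
      exact ((hi.1.sub hm₀.1).mul (Lp.aestronglyMeasurable f)).enorm.pow_const 2
    · filter_upwards [hc] with i hi
      refine Eventually.of_forall fun ξ => ?_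
      rw [enorm_mul]
      gcongr
      rw [← ofReal_norm]
      exact ENNReal.ofReal_le_ofReal ((norm_sub_le _ _).trans (add_le_add (hi ξ) (hc₀ ξ)))
    · simp_rw [mul_pow]
      rw [lintegral_const_mul'' _ ((Lp.aestronglyMeasurable f).enorm.pow_const 2)]
      refine ENNReal.mul_ne_top (by simp) ?_
      have := (Lp.memLp f).2
      rw [eLpNorm_two_eq, ENNReal.rpow_lt_top_iff_of_pos (by norm_num)] at this
      exact this.ne
    · refine Eventually.of_forall fun ξ => ?_
      have h1 : Tendsto (fun i => (m i ξ - m₀ ξ) * f ξ) l (𝓝 ((m₀ ξ - m₀ ξ) * f ξ)) :=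
        ((h ξ).sub_const _).mul_const _
      have h2 := ENNReal.Tendsto.pow (n := 2) h1.enorm
      simpa using h2
  have key2 := key.ennrpow_const (1 / 2 : ℝ)
  simp only [lintegral_zero] at key2
  rw [ENNReal.zero_rpow_of_pos (by norm_num)] at key2
  refine key2.congr' ?_
  filter_upwards [hm] with i hi
  rw [← eLpNorm_two_eq]
  refine eLpNorm_congr_ae ?_
  filter_upwards [mulL_coeFn hi f, mulL_coeFn hm₀ f] with ξ h1 h2
  simp [h1, h2, sub_mul]

/-! ### Convolution on the Fourier side -/

/-- Young's inequality `L¹ * L² ⊆ L²`, for nonnegative functions. -/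
theorem lintegral_sq_conv_le {A B : E3 → ℝ≥0∞} (hA : AEMeasurable A volume)
    (hB : AEMeasurable B volume) :
    ∫⁻ ξ, (∫⁻ η, A η * B (ξ - η)) ^ 2 ≤ (∫⁻ η, A η) ^ 2 * ∫⁻ ξ, B ξ ^ 2 := by
  have hBs : ∀ ξ : E3, AEMeasurable (fun η => B (ξ - η)) volume := fun ξ =>
    hB.comp_quasiMeasurePreserving (quasiMeasurePreserving_sub_left volume ξ)
  have hsq : ∀ x : ℝ≥0∞, (x ^ (1 / 2 : ℝ)) ^ 2 = x := fun x => by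
    rw [← ENNReal.rpow_natCast, ← ENNReal.rpow_mul]; norm_num
  -- Cauchy-Schwarz for the measure with density `A`
  have cs : ∀ ξ, (∫⁻ η, A η * B (ξ - η)) ^ 2 ≤ (∫⁻ η, A η) * ∫⁻ η, A η * B (ξ - η) ^ 2 := by
    intro ξ
    have h := ENNReal.lintegral_mul_le_Lp_mul_Lq volume (Real.HolderConjugate.two_two)
      (f := fun η => A η ^ (1 / 2 : ℝ)) (g := fun η => A η ^ (1 / 2 : ℝ) * B (ξ - η))
      (hA.pow_const _) ((hA.pow_const _).mul (hBs ξ))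
    have h' := pow_le_pow_left' h 2
    simp only [ENNReal.rpow_two, mul_pow, hsq, Pi.mul_apply, ← mul_assoc, ← pow_two] at h'
    exact h'
  have hm : AEMeasurable (Function.uncurry fun ξ η : E3 => A η * B (ξ - η) ^ 2)
      (volume.prod volume) := by
    refine (hA.comp_quasiMeasurePreserving Measure.quasiMeasurePreserving_snd).mul ?_
    exact (hB.comp_quasiMeasurePreserving
      (quasiMeasurePreserving_sub_of_right_invariant volume volume)).pow_const 2
  calc ∫⁻ ξ, (∫⁻ η, A η * B (ξ - η)) ^ 2
      ≤ ∫⁻ ξ, (∫⁻ η, A η) * ∫⁻ η, A η * B (ξ - η) ^ 2 := lintegral_mono cs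
    _ = (∫⁻ η, A η) * ∫⁻ ξ, ∫⁻ η, A η * B (ξ - η) ^ 2 :=
        lintegral_const_mul'' _ hm.lintegral_prod_right'
    _ = (∫⁻ η, A η) * ∫⁻ η, ∫⁻ ξ, A η * B (ξ - η) ^ 2 := by
        rw [lintegral_lintegral_swap hm]
    _ = (∫⁻ η, A η) * ∫⁻ η, A η * ∫⁻ ξ, B ξ ^ 2 := by
        congr 1
        refine lintegral_congr fun η => ?_
        have hBη : AEMeasurable (fun ξ => B (ξ - η) ^ 2) volume :=
          (hB.comp_quasiMeasurePreserving
            (measurePreserving_sub_right volume η).quasiMeasurePreserving).pow_const 2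
        rw [lintegral_const_mul'' _ hBη, lintegral_sub_right_eq_self (fun ξ => B ξ ^ 2) η]
    _ = (∫⁻ η, A η) ^ 2 * ∫⁻ ξ, B ξ ^ 2 := by
        rw [lintegral_mul_const'' _ hA, ← mul_assoc, ← pow_two]

/-- The convolution of two functions on frequency space. -/
def conv (a b : E3 → ℂ) : E3 → ℂ := convolution a b (ContinuousLinearMap.mul ℂ ℂ) volume

theorem conv_apply (a b : E3 → ℂ) (ξ : E3) : conv a b ξ = ∫ η, a η * b (ξ - η) := rfl

theorem conv_congr {a a' b b' : E3 → ℂ} (ha : a =ᵐ[volume] a') (hb : b =ᵐ[volume] b') :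
    conv a b = conv a' b' :=
  convolution_congr _ ha hb

theorem memLp_comp_sub {b : E3 → ℂ} (hb : MemLp b 2 volume) (ξ : E3) :
    MemLp (fun η => b (ξ - η)) 2 volume :=
  hb.comp_measurePreserving (Measure.measurePreserving_sub_left volume ξ)

theorem integrable_conv_integrand {a b : E3 → ℂ} (ha : MemLp a 2 volume) (hb : MemLp b 2 volume)
    (ξ : E3) : Integrable (fun η => a η * b (ξ - η)) volume :=
  ha.integrable_mul (memLp_comp_sub hb ξ)

theorem aestronglyMeasurable_conv {a b : E3 → ℂ} (ha : AEStronglyMeasurable a volume)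
    (hb : AEStronglyMeasurable b volume) : AEStronglyMeasurable (conv a b) volume :=
  (ha.convolution_integrand (ContinuousLinearMap.mul ℂ ℂ) hb).integral_prod_right'

theorem conv_add_right {a b b' : E3 → ℂ} (ha : MemLp a 2 volume) (hb : MemLp b 2 volume)
    (hb' : MemLp b' 2 volume) (ξ : E3) :
    conv a (fun η => b η + b' η) ξ = conv a b ξ + conv a b' ξ := by
  simp only [conv_apply, mul_add]
  exact integral_add (integrable_conv_integrand ha hb ξ) (integrable_conv_integrand ha hb' ξ)

theorem conv_sub_right {a b b' : E3 → ℂ} (ha : MemLp a 2 volume) (hb : MemLp b 2 volume)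
    (hb' : MemLp b' 2 volume) (ξ : E3) :
    conv a (fun η => b η - b' η) ξ = conv a b ξ - conv a b' ξ := by
  simp only [conv_apply, mul_sub]
  exact integral_sub (integrable_conv_integrand ha hb ξ) (integrable_conv_integrand ha hb' ξ)

theorem conv_sub_left {a a' b : E3 → ℂ} (ha : MemLp a 2 volume) (ha' : MemLp a' 2 volume)
    (hb : MemLp b 2 volume) (ξ : E3) :
    conv (fun η => a η - a' η) b ξ = conv a b ξ - conv a' b ξ := by
  simp only [conv_apply, sub_mul]
  exact integral_sub (integrable_conv_integrand ha hb ξ) (integrable_conv_integrand ha' hb ξ)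

theorem conv_smul_right (a b : E3 → ℂ) (c : ℂ) (ξ : E3) :
    conv a (fun η => c * b η) ξ = c * conv a b ξ := by
  simp only [conv_apply, mul_left_comm _ c]
  exact integral_const_mul _ _

theorem enorm_conv_le (a b : E3 → ℂ) (ξ : E3) :
    ‖conv a b ξ‖ₑ ≤ ∫⁻ η, ‖a η‖ₑ * ‖b (ξ - η)‖ₑ := by
  rw [conv_apply]
  refine (enorm_integral_le_lintegral_enorm _).trans (le_of_eq ?_)
  simp only [enorm_mul]

theorem eLpNorm_conv_le {a b : E3 → ℂ} (ha : AEStronglyMeasurable a volume)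
    (hb : AEStronglyMeasurable b volume) :
    eLpNorm (conv a b) 2 volume ≤ (∫⁻ η, ‖a η‖ₑ) * eLpNorm b 2 volume := by
  have h : ∫⁻ ξ, ‖conv a b ξ‖ₑ ^ 2 ≤ (∫⁻ η, ‖a η‖ₑ) ^ 2 * ∫⁻ ξ, ‖b ξ‖ₑ ^ 2 :=
    (lintegral_mono fun ξ => pow_le_pow_left' (enorm_conv_le a b ξ) 2).trans
      (lintegral_sq_conv_le ha.enorm hb.enorm)
  rw [eLpNorm_two_eq, eLpNorm_two_eq]
  refine (ENNReal.rpow_le_rpow h (by norm_num : (0 : ℝ) ≤ 1 / 2)).trans (le_of_eq ?_)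
  rw [ENNReal.mul_rpow_of_nonneg _ _ (by norm_num), ← ENNReal.rpow_natCast, ← ENNReal.rpow_mul]
  norm_num

theorem memLp_conv {a b : E3 → ℂ} (ha : Integrable a volume) (hb : MemLp b 2 volume) :
    MemLp (conv a b) 2 volume :=
  ⟨aestronglyMeasurable_conv ha.1 hb.1,
    (eLpNorm_conv_le ha.1 hb.1).trans_lt (ENNReal.mul_lt_top ha.2 hb.2)⟩

/-- Convolution with `a ∈ L¹ ∩ L²` as a bounded operator on `L²`. -/
def convL (a : L2C) (ha : Integrable a volume) : L2C →L[ℂ] L2C :=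
  LinearMap.mkContinuous
    { toFun := fun b => (memLp_conv ha (Lp.memLp b)).toLp _
      map_add' := fun b b' => by
        refine Lp.ext ?_
        filter_upwards [(memLp_conv ha (Lp.memLp (b + b'))).coeFn_toLp,
          Lp.coeFn_add ((memLp_conv ha (Lp.memLp b)).toLp _)
            ((memLp_conv ha (Lp.memLp b')).toLp _),
          (memLp_conv ha (Lp.memLp b)).coeFn_toLp,
          (memLp_conv ha (Lp.memLp b')).coeFn_toLp] with ξ h1 h2 h3 h4
        rw [h1, h2, Pi.add_apply, h3, h4,
          ← conv_add_right (Lp.memLp a) (Lp.memLp b) (Lp.memLp b')]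
        exact congrFun (conv_congr (EventuallyEq.refl _ _) (Lp.coeFn_add b b')) ξ
      map_smul' := fun c b => by
        refine Lp.ext ?_
        filter_upwards [(memLp_conv ha (Lp.memLp (c • b))).coeFn_toLp,
          Lp.coeFn_smul c ((memLp_conv ha (Lp.memLp b)).toLp _),
          (memLp_conv ha (Lp.memLp b)).coeFn_toLp] with ξ h1 h2 h3
        rw [h1, RingHom.id_apply, h2, Pi.smul_apply, h3, smul_eq_mul, ← conv_smul_right]
        exact congrFun (conv_congr (EventuallyEq.refl _ _) (Lp.coeFn_smul c b)) ξ }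
    (∫⁻ η, ‖a η‖ₑ).toReal fun b => by
      simp only [LinearMap.coe_mk, AddHom.coe_mk]
      rw [Lp.norm_toLp, Lp.norm_def, ← ENNReal.toReal_mul]
      exact ENNReal.toReal_mono (ENNReal.mul_ne_top ha.2.ne (Lp.eLpNorm_ne_top b))
        (eLpNorm_conv_le ha.1 (Lp.aestronglyMeasurable b))

theorem convL_coeFn (a : L2C) (ha : Integrable a volume) (b : L2C) :
    convL a ha b =ᵐ[volume] conv a b :=
  (memLp_conv ha (Lp.memLp b)).coeFn_toLp

theorem continuous_neg_inner : Continuous fun p : E3 × E3 => (-innerₗ E3) p.1 p.2 :=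
  (continuous_inner (𝕜 := ℝ) (E := E3)).neg

/-- On `L¹ ∩ L²` the unitary inverse Fourier transform is given by the Fourier integral. -/
theorem fourierInv_toLp_ae {f : E3 → ℂ} (h1 : Integrable f volume) (h2 : MemLp f 2 volume) :
    (𝓕⁻ (h2.toLp f) : L2C) =ᵐ[volume] 𝓕⁻ f := by
  set g : L2C := 𝓕⁻ (h2.toLp f) with hg
  have hcont : Continuous (𝓕⁻ f) :=
    VectorFourier.fourierIntegral_continuous Real.continuous_fourierChar
      continuous_neg_inner h1
  refine ae_eq_of_integral_contDiff_smul_eq ((Lp.memLp g).locallyIntegrable one_le_two)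
    hcont.locallyIntegrable ?_
  intro φ hφ hc
  have hg₁ : HasCompactSupport (Complex.ofRealCLM ∘ φ) := hc.comp_left rfl
  have hg₂ : ContDiff ℝ (⊤ : ℕ∞) (Complex.ofRealCLM ∘ φ) := by fun_prop
  set ψ := hg₁.toSchwartzMap hg₂ with hψ
  have hx : ∀ x, ψ x = (φ x : ℂ) := fun x => by simp [hψ]
  have e1 := DFunLike.congr_fun (Lp.fourierInv_toTemperedDistribution_eq (h2.toLp f)) ψ
  rw [TemperedDistribution.fourierInv_apply, Lp.toTemperedDistribution_apply,
    Lp.toTemperedDistribution_apply] at e1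
  have e2 : ∫ x, (𝓕⁻ (ψ : E3 → ℂ)) x • f x = ∫ x, ψ x • (𝓕⁻ f) x := by
    have := VectorFourier.integral_fourierIntegral_smul_eq_flip (L := -innerₗ E3) (f := ψ) (g := f)
      (μ := volume) (ν := volume)
      Real.continuous_fourierChar continuous_neg_inner ψ.integrable h1
    have hflip : (-innerₗ E3).flip = -innerₗ E3 := by
      ext x y
      simp [real_inner_comm]
    rw [hflip] at this
    exact this
  simp_rw [← Complex.coe_smul, ← hx]
  rw [← e2, ← e1]
  refine integral_congr_ae ?_
  filter_upwards [h2.coeFn_toLp] with x hx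
  rw [hx, SchwartzMap.fourierInv_coe]

theorem memLp_top_fourierInv {f : E3 → ℂ} (h1 : Integrable f volume) : MemLp (𝓕⁻ f) ∞ volume := by
  have hcont : Continuous (𝓕⁻ f) :=
    VectorFourier.fourierIntegral_continuous Real.continuous_fourierChar
      continuous_neg_inner h1
  exact memLp_top_of_bound hcont.aestronglyMeasurable (∫ v, ‖f v‖)
    (Eventually.of_forall fun x => VectorFourier.norm_fourierIntegral_le_integral_norm ..)

theorem fourierInv_conv {f g : E3 → ℂ} (hf : Integrable f volume) (hg : Integrable g volume)
    (x : E3) : 𝓕⁻ (conv f g) x = 𝓕⁻ f x * 𝓕⁻ g x := by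
  simp only [Real.fourierInv_eq_fourier_neg]
  exact Real.fourier_mul_convolution_eq hf hg (-x)

/-- The inverse Fourier transform turns convolutions into products, if one of the two factors is
in `L¹ ∩ L²` and the other one in `L²`. -/
theorem mulL_fourierInv_eq (a : L2C) (ha : Integrable a volume) (b : L2C) :
    mulL (𝓕⁻ (a : E3 → ℂ)) (𝓕⁻ b) = 𝓕⁻ (convL a ha b) := by
  refine DenseRange.induction_on
    (p := fun b : L2C => mulL (𝓕⁻ (a : E3 → ℂ)) (𝓕⁻ b) = 𝓕⁻ (convL a ha b))
    (SchwartzMap.denseRange_toLpCLM (p := 2) ENNReal.ofNat_ne_top) b ?_ ?_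
  · refine isClosed_eq ?_ ?_
    · exact (mulL _).continuous.comp (Lp.fourierTransformₗᵢ E3 ℂ).symm.continuous
    · exact (Lp.fourierTransformₗᵢ E3 ℂ).symm.continuous.comp (convL a ha).continuous
  intro φ
  have e0 : (SchwartzMap.toLpCLM ℝ ℂ 2 volume φ : L2C) = φ.toLp 2 := rfl
  rw [e0]
  have hφ : (φ.toLp 2 : L2C) =ᵐ[volume] φ := φ.coeFn_toLp 2
  have hc : conv a (φ.toLp 2 : L2C) = conv a φ := conv_congr (EventuallyEq.refl _ _) hφ
  have h2 : MemLp (conv a φ) 2 volume := memLp_conv ha (φ.memLp 2)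
  have h1 : Integrable (conv a φ) volume :=
    ha.integrable_convolution (ContinuousLinearMap.mul ℂ ℂ) φ.integrable
  have hcl : convL a ha (φ.toLp 2) = h2.toLp _ := by
    refine Lp.ext ((convL_coeFn a ha _).trans ?_)
    rw [hc]
    exact h2.coeFn_toLp.symm
  rw [hcl, SchwartzMap.toLp_fourierInv_eq]
  refine Lp.ext ?_
  filter_upwards [mulL_coeFn (memLp_top_fourierInv ha) ((𝓕⁻ φ).toLp 2),
    fourierInv_toLp_ae h1 h2, (𝓕⁻ φ).coeFn_toLp 2] with x k1 k2 k3
  rw [k1, k2, k3, fourierInv_conv ha φ.integrable, SchwartzMap.fourierInv_coe]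

theorem mulL2_fourierInv (a : L2C) (ha : Integrable a volume) (b : L2C) :
    mulL2 (𝓕⁻ a) (𝓕⁻ b) = 𝓕⁻ (convL a ha b) := by
  have h0 : (𝓕⁻ a : L2C) =ᵐ[volume] 𝓕⁻ (a : E3 → ℂ) := by
    have := fourierInv_toLp_ae ha (Lp.memLp a)
    rwa [Lp.toLp_coeFn] at this
  have h1 : (mulL (𝓕⁻ (a : E3 → ℂ)) (𝓕⁻ b) : L2C) =ᵐ[volume]
      fun x => (𝓕⁻ a : L2C) x * (𝓕⁻ b : L2C) x := by
    filter_upwards [h0, mulL_coeFn (memLp_top_fourierInv ha) (𝓕⁻ b)] with x k1 k2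
    rw [k2, k1]
  have h2 : MemLp (fun x => (𝓕⁻ a : L2C) x * (𝓕⁻ b : L2C) x) 2 volume :=
    (memLp_congr_ae h1).mp (Lp.memLp _)
  rw [mulL2, dif_pos h2, ← mulL_fourierInv_eq a ha b]
  exact Lp.ext (h2.coeFn_toLp.trans h1.symm)

/-! ### Sobolev weights and the algebra property of `H^s` -/

/-- The Sobolev weight `(1 + |2πξ|²)^(s/2)`. -/
def bracket (s : ℝ) (ξ : E3) : ℝ := (1 + (2 * Real.pi * ‖ξ‖) ^ 2) ^ (s / 2)

/-- The reciprocal of the Sobolev weight, as a complex-valued symbol. -/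
def invBracket (s : ℝ) (ξ : E3) : ℂ := ((bracket s ξ)⁻¹ : ℝ)

theorem bracket_pos (s : ℝ) (ξ : E3) : 0 < bracket s ξ := by
  unfold bracket; positivity

theorem one_le_bracket {s : ℝ} (hs : 0 ≤ s) (ξ : E3) : 1 ≤ bracket s ξ :=
  Real.one_le_rpow (by nlinarith [sq_nonneg (2 * Real.pi * ‖ξ‖)]) (by positivity)

theorem continuous_bracket (s : ℝ) : Continuous (bracket s) := by
  refine Continuous.rpow_const (by fun_prop) ?_
  intro x; left; positivity

theorem continuous_invBracket (s : ℝ) : Continuous (invBracket s) :=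
  Complex.continuous_ofReal.comp ((continuous_bracket s).inv₀ fun ξ => (bracket_pos s ξ).ne')

theorem invBracket_ne_zero (s : ℝ) (ξ : E3) : invBracket s ξ ≠ 0 := by
  simpa [invBracket] using (bracket_pos s ξ).ne'

theorem bracket_mul_invBracket (s : ℝ) (ξ : E3) : (bracket s ξ : ℂ) * invBracket s ξ = 1 := by
  rw [invBracket, ← Complex.ofReal_mul, mul_inv_cancel₀ (bracket_pos s ξ).ne', Complex.ofReal_one]

theorem norm_invBracket (s : ℝ) (ξ : E3) : ‖invBracket s ξ‖ = (bracket s ξ)⁻¹ := by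
  rw [invBracket, Complex.norm_real, Real.norm_of_nonneg (inv_nonneg.mpr (bracket_pos s ξ).le)]

theorem memLp_top_invBracket {s : ℝ} (hs : 0 ≤ s) : MemLp (invBracket s) ∞ volume :=
  memLp_top_of_bound (continuous_invBracket s).aestronglyMeasurable 1
    (Eventually.of_forall fun ξ => by
      rw [norm_invBracket]; exact inv_le_one_of_one_le₀ (one_le_bracket hs ξ))

theorem memLp_two_invBracket {s : ℝ} (hs : 3 / 2 < s) : MemLp (invBracket s) 2 volume := by
  rw [memLp_two_iff_integrable_sq_norm (continuous_invBracket s).aestronglyMeasurable]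
  have h := integrable_rpow_neg_one_add_norm_sq (E := E3) (μ := volume) (r := 2 * s)
    (by simp; linarith)
  refine h.mono' ((continuous_invBracket s).norm.pow 2).aestronglyMeasurable
    (Eventually.of_forall fun ξ => ?_)
  have hpi : 1 ≤ 2 * Real.pi := by linarith [Real.pi_gt_three]
  rw [norm_invBracket, Real.norm_of_nonneg (by positivity), bracket,
    ← Real.rpow_neg (by positivity),
    ← Real.rpow_natCast, ← Real.rpow_mul (by positivity)]
  have e : -(s / 2) * ((2 : ℕ) : ℝ) = -(2 * s) / 2 := by push_cast; ring
  rw [e]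
  refine Real.rpow_le_rpow_of_nonpos (by positivity) ?_ (by linarith)
  gcongr
  nlinarith [norm_nonneg ξ]

/-- Peetre's inequality, in additive form. -/
theorem bracket_add_le {s : ℝ} (hs : 0 ≤ s) (ξ η : E3) :
    bracket s (ξ + η) ≤ 2 ^ s * (bracket s ξ + bracket s η) := by
  have aux : ∀ ξ η : E3, ‖ξ‖ ≤ ‖η‖ → bracket s (ξ + η) ≤ 2 ^ s * bracket s η := by
    intro ξ η h
    have e : (2 : ℝ) ^ s = (4 : ℝ) ^ (s / 2) := by
      rw [show (4 : ℝ) = 2 ^ (2 : ℝ) by norm_num, ← Real.rpow_mul (by norm_num)]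
      congr 1; ring
    rw [e, bracket, bracket, ← Real.mul_rpow (by norm_num) (by positivity)]
    refine Real.rpow_le_rpow (by positivity) ?_ (by positivity)
    have h1 : ‖ξ + η‖ ≤ 2 * ‖η‖ := (norm_add_le _ _).trans (by linarith)
    have h2 : (2 * Real.pi * ‖ξ + η‖) ^ 2 ≤ (2 * Real.pi * (2 * ‖η‖)) ^ 2 := by gcongr
    nlinarith
  have h2 : (0 : ℝ) < 2 ^ s := by positivity
  rcases le_total ‖ξ‖ ‖η‖ with h | h
  · refine (aux ξ η h).trans ?_
    gcongr
    linarith [bracket_pos s ξ]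
  · rw [add_comm ξ]
    refine (aux η ξ h).trans ?_
    gcongr
    linarith [bracket_pos s η]

/-- The Bessel potential `(1 - Δ)^(-s/2)` on the Fourier side. A square integrable `g` stands for
the function in `H^s` with the Fourier transform `bessel s g`. -/
def bessel (s : ℝ) : L2C →L[ℂ] L2C := mulL (invBracket s)

theorem bessel_coeFn {s : ℝ} (hs : 0 ≤ s) (g : L2C) :
    bessel s g =ᵐ[volume] fun ξ => invBracket s ξ * g ξ :=
  mulL_coeFn (memLp_top_invBracket hs) g

theorem bessel_injective {s : ℝ} (hs : 0 ≤ s) : Function.Injective (bessel s) :=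
  mulL_injective (memLp_top_invBracket hs) (invBracket_ne_zero s)

theorem lintegral_mul_sq_le {f g : E3 → ℝ≥0∞} (hf : AEMeasurable f volume)
    (hg : AEMeasurable g volume) :
    (∫⁻ ξ, f ξ * g ξ) ^ 2 ≤ (∫⁻ ξ, f ξ ^ 2) * ∫⁻ ξ, g ξ ^ 2 := by
  have h := ENNReal.lintegral_mul_le_Lp_mul_Lq volume Real.HolderConjugate.two_two hf hg
  have hsq : ∀ x : ℝ≥0∞, (x ^ (1 / 2 : ℝ)) ^ 2 = x := fun x => by
    rw [← ENNReal.rpow_natCast, ← ENNReal.rpow_mul]; norm_num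
  have h' := pow_le_pow_left' h 2
  simpa only [ENNReal.rpow_two, mul_pow, hsq, Pi.mul_apply] using h'

theorem integrable_bessel {s : ℝ} (hs : 3 / 2 < s) (g : L2C) :
    Integrable (bessel s g) volume := by
  refine Integrable.congr ?_ (bessel_coeFn (by linarith) g).symm
  exact (memLp_two_invBracket hs).integrable_mul (Lp.memLp g)

/-- The constant in the algebra property of `H^s`. -/
def algConst (s : ℝ) : ℝ≥0∞ :=
  ENNReal.ofReal (2 ^ s) ^ 2 * (4 * ∫⁻ ξ, ‖invBracket s ξ‖ₑ ^ 2)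

theorem algConst_ne_top {s : ℝ} (hs : 3 / 2 < s) : algConst s ≠ ∞ := by
  refine ENNReal.mul_ne_top (by simp) (ENNReal.mul_ne_top (by simp) ?_)
  have := (memLp_two_invBracket hs).2
  rw [eLpNorm_two_eq, ENNReal.rpow_lt_top_iff_of_pos (by norm_num)] at this
  exact this.ne

/-- Peetre's inequality moves the weight from the convolution onto one of its factors. -/
theorem enorm_bracket_mul_conv_le {s : ℝ} (hs : 0 ≤ s) (g h : E3 → ℂ) (ξ : E3) :
    ‖(bracket s ξ : ℂ) * conv (fun η => invBracket s η * g η) (fun η => invBracket s η * h η) ξ‖ₑ ≤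
      ENNReal.ofReal (2 ^ s) * ∫⁻ η, (‖g η‖ₑ * ‖invBracket s (ξ - η) * h (ξ - η)‖ₑ +
        ‖invBracket s η * g η‖ₑ * ‖h (ξ - η)‖ₑ) := by
  have hw : ∀ ζ, ENNReal.ofReal (bracket s ζ) * ‖invBracket s ζ‖ₑ = 1 := fun ζ => by
    rw [← ofReal_norm, norm_invBracket, ← ENNReal.ofReal_mul (bracket_pos s ζ).le,
      mul_inv_cancel₀ (bracket_pos s ζ).ne', ENNReal.ofReal_one]
  have hb : ‖(bracket s ξ : ℂ)‖ₑ = ENNReal.ofReal (bracket s ξ) := by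
    rw [← ofReal_norm, Complex.norm_real, Real.norm_of_nonneg (bracket_pos s ξ).le]
  rw [enorm_mul, hb]
  refine (mul_le_mul_right (enorm_conv_le _ _ ξ) _).trans ?_
  rw [← lintegral_const_mul' _ _ ENNReal.ofReal_ne_top,
    ← lintegral_const_mul' _ _ ENNReal.ofReal_ne_top]
  refine lintegral_mono fun η => ?_
  have hp : ENNReal.ofReal (bracket s ξ) ≤ ENNReal.ofReal (2 ^ s) *
      (ENNReal.ofReal (bracket s η) + ENNReal.ofReal (bracket s (ξ - η))) := by
    rw [← ENNReal.ofReal_add (bracket_pos s _).le (bracket_pos s _).le,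
      ← ENNReal.ofReal_mul (by positivity)]
    refine ENNReal.ofReal_le_ofReal ?_
    have := bracket_add_le hs η (ξ - η)
    rwa [add_sub_cancel] at this
  refine (mul_le_mul_left hp _).trans (le_of_eq ?_)
  simp only [enorm_mul]
  calc _ = ENNReal.ofReal (2 ^ s) *
        ((ENNReal.ofReal (bracket s η) * ‖invBracket s η‖ₑ) *
          (‖g η‖ₑ * (‖invBracket s (ξ - η)‖ₑ * ‖h (ξ - η)‖ₑ)) +
        (ENNReal.ofReal (bracket s (ξ - η)) * ‖invBracket s (ξ - η)‖ₑ) *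
          (‖invBracket s η‖ₑ * ‖g η‖ₑ * ‖h (ξ - η)‖ₑ)) := by ring
    _ = _ := by rw [hw, hw, one_mul, one_mul]

theorem lintegral_bracket_conv_le {s : ℝ} (hs : 3 / 2 < s) (g h : L2C) :
    ∫⁻ ξ, ‖(bracket s ξ : ℂ) *
        conv (fun η => invBracket s η * g η) (fun η => invBracket s η * h η) ξ‖ₑ ^ 2 ≤
      algConst s * ((∫⁻ ξ, ‖g ξ‖ₑ ^ 2) * ∫⁻ ξ, ‖h ξ‖ₑ ^ 2) := by
  have hg := (Lp.aestronglyMeasurable g).enorm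
  have hh := (Lp.aestronglyMeasurable h).enorm
  have hj : AEMeasurable (fun ξ => ‖invBracket s ξ‖ₑ) volume :=
    (continuous_invBracket s).aestronglyMeasurable.enorm
  have hjg : AEMeasurable (fun ξ => ‖invBracket s ξ * g ξ‖ₑ) volume :=
    ((continuous_invBracket s).aestronglyMeasurable.mul (Lp.aestronglyMeasurable g)).enorm
  have hjh : AEMeasurable (fun ξ => ‖invBracket s ξ * h ξ‖ₑ) volume :=
    ((continuous_invBracket s).aestronglyMeasurable.mul (Lp.aestronglyMeasurable h)).enorm
  set a : E3 → ℝ≥0∞ := fun ξ => ‖invBracket s ξ * g ξ‖ₑ with ha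
  set b : E3 → ℝ≥0∞ := fun ξ => ‖invBracket s ξ * h ξ‖ₑ with hb
  set N := ∫⁻ ξ, ‖invBracket s ξ‖ₑ ^ 2 with hN
  have hsub : ∀ {B : E3 → ℝ≥0∞}, AEMeasurable B volume → ∀ ξ : E3,
      AEMeasurable (fun η => B (ξ - η)) volume := fun hB ξ =>
    hB.comp_quasiMeasurePreserving (quasiMeasurePreserving_sub_left volume ξ)
  have two_sq : ∀ x y : ℝ≥0∞, (x + y) ^ 2 ≤ 2 * x ^ 2 + 2 * y ^ 2 := fun x y => by
    have := ENNReal.rpow_add_le_mul_rpow_add_rpow x y (p := 2) (by norm_num)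
    rw [mul_add] at this
    norm_num at this
    exact this
  have cs1 : (∫⁻ ξ, b ξ) ^ 2 ≤ N * ∫⁻ ξ, ‖h ξ‖ₑ ^ 2 := by
    simp only [hb, enorm_mul]
    exact lintegral_mul_sq_le hj hh
  have cs2 : (∫⁻ ξ, a ξ) ^ 2 ≤ N * ∫⁻ ξ, ‖g ξ‖ₑ ^ 2 := by
    simp only [ha, enorm_mul]
    exact lintegral_mul_sq_le hj hg
  have y1 : ∫⁻ ξ, (∫⁻ η, ‖g η‖ₑ * b (ξ - η)) ^ 2 ≤
      N * ((∫⁻ ξ, ‖g ξ‖ₑ ^ 2) * ∫⁻ ξ, ‖h ξ‖ₑ ^ 2) := by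
    have flip : ∀ ξ, ∫⁻ η, ‖g η‖ₑ * b (ξ - η) = ∫⁻ η, b η * ‖g (ξ - η)‖ₑ := by
      intro ξ
      rw [← lintegral_sub_left_eq_self (fun η => b η * ‖g (ξ - η)‖ₑ) ξ]
      simp only [sub_sub_cancel, mul_comm]
    simp only [flip]
    refine (lintegral_sq_conv_le hjh hg).trans ?_
    refine (mul_le_mul_left cs1 _).trans (le_of_eq (by ring))
  have y2 : ∫⁻ ξ, (∫⁻ η, a η * ‖h (ξ - η)‖ₑ) ^ 2 ≤
      N * ((∫⁻ ξ, ‖g ξ‖ₑ ^ 2) * ∫⁻ ξ, ‖h ξ‖ₑ ^ 2) := by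
    refine (lintegral_sq_conv_le hjg hh).trans ?_
    refine (mul_le_mul_left cs2 _).trans (le_of_eq (by ring))
  have m1 : AEMeasurable (fun ξ => (∫⁻ η, ‖g η‖ₑ * b (ξ - η)) ^ 2) volume := by
    have : AEMeasurable (Function.uncurry fun ξ η : E3 => ‖g η‖ₑ * b (ξ - η))
        (volume.prod volume) :=
      (hg.comp_quasiMeasurePreserving Measure.quasiMeasurePreserving_snd).mul
        (hjh.comp_quasiMeasurePreserving
          (quasiMeasurePreserving_sub_of_right_invariant volume volume))
    exact this.lintegral_prod_right'.pow_const 2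
  calc _ ≤ ∫⁻ ξ, ENNReal.ofReal (2 ^ s) ^ 2 * (2 * (∫⁻ η, ‖g η‖ₑ * b (ξ - η)) ^ 2 +
          2 * (∫⁻ η, a η * ‖h (ξ - η)‖ₑ) ^ 2) := by
        refine lintegral_mono fun ξ => ?_
        refine (pow_le_pow_left' (enorm_bracket_mul_conv_le (by linarith) g h ξ) 2).trans ?_
        have hadd := lintegral_add_left' (hg.mul (hsub hjh ξ)) fun η => a η * ‖h (ξ - η)‖ₑ
        simp only [Pi.mul_apply, ha, hb] at hadd ⊢
        rw [mul_pow, hadd]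
        gcongr
        exact two_sq _ _
    _ = ENNReal.ofReal (2 ^ s) ^ 2 * (2 * (∫⁻ ξ, (∫⁻ η, ‖g η‖ₑ * b (ξ - η)) ^ 2) +
          2 * ∫⁻ ξ, (∫⁻ η, a η * ‖h (ξ - η)‖ₑ) ^ 2) := by
        rw [lintegral_const_mul' _ _ (by simp), lintegral_add_left' (m1.const_mul _),
          lintegral_const_mul' _ _ (by simp), lintegral_const_mul' _ _ (by simp)]
    _ ≤ ENNReal.ofReal (2 ^ s) ^ 2 * (2 * (N * ((∫⁻ ξ, ‖g ξ‖ₑ ^ 2) * ∫⁻ ξ, ‖h ξ‖ₑ ^ 2)) +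
          2 * (N * ((∫⁻ ξ, ‖g ξ‖ₑ ^ 2) * ∫⁻ ξ, ‖h ξ‖ₑ ^ 2))) := by gcongr
    _ = _ := by rw [algConst]; ring

theorem conv_bessel {s : ℝ} (hs : 0 ≤ s) (g h : L2C) :
    conv (bessel s g) (bessel s h) =
      conv (fun η => invBracket s η * g η) (fun η => invBracket s η * h η) :=
  conv_congr (bessel_coeFn hs g) (bessel_coeFn hs h)

/-- The algebra property of `H^s` for the Fourier transforms: the product becomes a convolution. -/
theorem eLpNorm_bracket_conv_le {s : ℝ} (hs : 3 / 2 < s) (g h : L2C) :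
    eLpNorm (fun ξ => (bracket s ξ : ℂ) * conv (bessel s g) (bessel s h) ξ) 2 volume ≤
      algConst s ^ (1 / 2 : ℝ) * (eLpNorm g 2 volume * eLpNorm h 2 volume) := by
  rw [conv_bessel (by linarith), eLpNorm_two_eq, eLpNorm_two_eq, eLpNorm_two_eq,
    ← ENNReal.mul_rpow_of_nonneg _ _ (by norm_num), ← ENNReal.mul_rpow_of_nonneg _ _ (by norm_num)]
  exact ENNReal.rpow_le_rpow (lintegral_bracket_conv_le hs g h) (by norm_num)

theorem memLp_bracket_conv {s : ℝ} (hs : 3 / 2 < s) (g h : L2C) :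
    MemLp (fun ξ => (bracket s ξ : ℂ) * conv (bessel s g) (bessel s h) ξ) 2 volume :=
  ⟨(Complex.continuous_ofReal.comp (continuous_bracket s)).aestronglyMeasurable.mul
      (aestronglyMeasurable_conv (Lp.aestronglyMeasurable _) (Lp.aestronglyMeasurable _)),
    (eLpNorm_bracket_conv_le hs g h).trans_lt (ENNReal.mul_lt_top
      (ENNReal.rpow_lt_top_of_nonneg (by norm_num) (algConst_ne_top hs))
      (ENNReal.mul_lt_top (Lp.memLp g).2 (Lp.memLp h).2))⟩

/-- The product on `H^s`, transported to `L²` by the isomorphism of `bessel`. -/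
def prodHs {s : ℝ} (hs : 3 / 2 < s) (g h : L2C) : L2C := (memLp_bracket_conv hs g h).toLp _

theorem prodHs_coeFn {s : ℝ} (hs : 3 / 2 < s) (g h : L2C) :
    prodHs hs g h =ᵐ[volume] fun ξ => (bracket s ξ : ℂ) * conv (bessel s g) (bessel s h) ξ :=
  (memLp_bracket_conv hs g h).coeFn_toLp

/-- `H^s` is an algebra for `s > 3/2`. -/
theorem norm_prodHs_le {s : ℝ} (hs : 3 / 2 < s) (g h : L2C) :
    ‖prodHs hs g h‖ ≤ (algConst s ^ (1 / 2 : ℝ)).toReal * (‖g‖ * ‖h‖) := by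
  rw [prodHs, Lp.norm_toLp, Lp.norm_def, Lp.norm_def, ← ENNReal.toReal_mul, ← ENNReal.toReal_mul]
  exact ENNReal.toReal_mono (ENNReal.mul_ne_top
    (ENNReal.rpow_lt_top_of_nonneg (by norm_num) (algConst_ne_top hs)).ne
    (ENNReal.mul_ne_top (Lp.eLpNorm_ne_top g) (Lp.eLpNorm_ne_top h)))
    (eLpNorm_bracket_conv_le hs g h)

theorem prodHs_sub_left {s : ℝ} (hs : 3 / 2 < s) (g g' h : L2C) :
    prodHs hs (g - g') h = prodHs hs g h - prodHs hs g' h := by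
  refine Lp.ext ?_
  filter_upwards [prodHs_coeFn hs (g - g') h, prodHs_coeFn hs g h, prodHs_coeFn hs g' h,
    Lp.coeFn_sub (prodHs hs g h) (prodHs hs g' h)] with ξ h1 h2 h3 h4
  rw [h1, h4, Pi.sub_apply, h2, h3, ← mul_sub,
    ← conv_sub_left (Lp.memLp _) (Lp.memLp _) (Lp.memLp _), map_sub]
  congr 1
  exact congrFun (conv_congr (Lp.coeFn_sub _ _) (EventuallyEq.refl _ _)) ξ

theorem prodHs_sub_right {s : ℝ} (hs : 3 / 2 < s) (g h h' : L2C) :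
    prodHs hs g (h - h') = prodHs hs g h - prodHs hs g h' := by
  refine Lp.ext ?_
  filter_upwards [prodHs_coeFn hs g (h - h'), prodHs_coeFn hs g h, prodHs_coeFn hs g h',
    Lp.coeFn_sub (prodHs hs g h) (prodHs hs g h')] with ξ h1 h2 h3 h4
  rw [h1, h4, Pi.sub_apply, h2, h3, ← mul_sub,
    ← conv_sub_right (Lp.memLp _) (Lp.memLp _) (Lp.memLp _), map_sub]
  congr 1
  exact congrFun (conv_congr (EventuallyEq.refl _ _) (Lp.coeFn_sub _ _)) ξ

/-- The convolution of two functions in weighted `L²` is the Fourier transform of a function in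
`H^s`. -/
theorem convL_bessel {s : ℝ} (hs : 3 / 2 < s) (g h : L2C) :
    convL (bessel s g) (integrable_bessel hs g) (bessel s h) = bessel s (prodHs hs g h) := by
  refine Lp.ext ?_
  filter_upwards [convL_coeFn (bessel s g) (integrable_bessel hs g) (bessel s h),
    bessel_coeFn (by linarith : 0 ≤ s) (prodHs hs g h), prodHs_coeFn hs g h] with ξ h1 h2 h3
  rw [h1, h2, h3, ← mul_assoc, mul_comm (invBracket s ξ), bracket_mul_invBracket, one_mul]

theorem norm_prodHs_sub_le {s : ℝ} (hs : 3 / 2 < s) (g g' h h' : L2C) :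
    ‖prodHs hs g h - prodHs hs g' h'‖ ≤
      (algConst s ^ (1 / 2 : ℝ)).toReal * (‖g - g'‖ * ‖h‖ + ‖g'‖ * ‖h - h'‖) := by
  have e : prodHs hs g h - prodHs hs g' h' = prodHs hs (g - g') h + prodHs hs g' (h - h') := by
    rw [prodHs_sub_left, prodHs_sub_right]; abel
  rw [e, mul_add]
  exact (norm_add_le _ _).trans (add_le_add (norm_prodHs_le hs _ _) (norm_prodHs_le hs _ _))

/-! ### Volterra equations with a weakly singular kernel -/

theorem continuous_of_locally_lipschitz {X Y : Type*} [NormedAddCommGroup X] [NormedAddCommGroup Y]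
    {Q : X → Y} {c : ℝ}
    (hQ : ∀ x x', ‖Q x - Q x'‖ ≤ c * (‖x‖ + ‖x'‖) * ‖x - x'‖) : Continuous Q := by
  refine continuous_iff_continuousAt.mpr fun x => ?_
  refine tendsto_iff_norm_sub_tendsto_zero.mpr ?_
  have h : Tendsto (fun z => c * (‖z‖ + ‖x‖) * ‖z - x‖) (𝓝 x) (𝓝 (c * (‖x‖ + ‖x‖) * ‖x - x‖)) :=
    Continuous.tendsto (by fun_prop) x
  rw [sub_self, norm_zero, mul_zero] at h
  exact squeeze_zero (fun z => norm_nonneg _) (fun z => hQ z x) h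

theorem exists_continuous_eqOn {Z : Type*} [TopologicalSpace Z] {T : ℝ} (hT : 0 ≤ T) {F : ℝ → Z}
    (hF : ContinuousOn F (Icc 0 T)) : ∃ F' : ℝ → Z, Continuous F' ∧ EqOn F' F (Icc 0 T) ∧
      ∀ τ, ∃ τ' ∈ Icc 0 T, F' τ = F τ' := by
  refine ⟨IccExtend hT (fun x : Icc 0 T => F x),
    (continuousOn_iff_continuous_domRestrict.mp hF).Icc_extend',
    fun x hx => IccExtend_of_mem hT _ hx, fun τ => ⟨_, (projIcc 0 T hT τ).2, rfl⟩⟩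

theorem exists_norm_le {X : Type*} [NormedAddCommGroup X] {T : ℝ} {F : ℝ → X}
    (hF : ContinuousOn F (Icc 0 T)) : ∃ M, 0 ≤ M ∧ ∀ τ ∈ Icc 0 T, ‖F τ‖ ≤ M := by
  obtain ⟨M, hM⟩ := isCompact_Icc.exists_bound_of_continuousOn hF
  exact ⟨max M 0, le_max_right _ _, fun τ hτ => (hM τ hτ).trans (le_max_left _ _)⟩

section Volterra

variable {X Y : Type*} [NormedAddCommGroup X] [NormedSpace ℝ X] [NormedAddCommGroup Y]
  [NormedSpace ℝ Y]

/-- An operator-valued kernel on `(0, ∞)`, strongly continuous, with the integrable singularity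
`A r^(-a)` at `r = 0`. Nothing is required for `r ≤ 0`. -/
structure IsSingularKernel (K : ℝ → Y →L[ℝ] X) (A a : ℝ) : Prop where
  exp_lt_one : a < 1
  const_nonneg : 0 ≤ A
  norm_le : ∀ r, 0 < r → ∀ y, ‖K r y‖ ≤ A * r ^ (-a) * ‖y‖
  cont : ∀ y, ContinuousOn (fun r => K r y) (Ioi 0)

theorem intervalIntegrable_sub_rpow {a : ℝ} (ha : a < 1) (t : ℝ) :
    IntervalIntegrable (fun τ => (t - τ) ^ (-a)) volume 0 t := by
  have h := (intervalIntegral.intervalIntegrable_rpow' (a := 0) (b := t)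
    (by linarith : -1 < -a)).comp_sub_left t
  simpa using h.symm

theorem integral_sub_rpow {a : ℝ} (ha : a < 1) (t : ℝ) :
    ∫ τ in (0 : ℝ)..t, (t - τ) ^ (-a) = t ^ (1 - a) / (1 - a) := by
  rw [intervalIntegral.integral_comp_sub_left (fun r => r ^ (-a)) t, sub_self, sub_zero,
    integral_rpow (Or.inl (by linarith)), Real.zero_rpow (by linarith), sub_zero, neg_add_eq_sub]

namespace IsSingularKernel

variable {K : ℝ → Y →L[ℝ] X} {A a : ℝ}

theorem tendsto (hK : IsSingularKernel K A a) {ι : Type*} {l : Filter ι} {ρ : ι → ℝ} {f : ι → Y}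
    {r : ℝ} {y : Y} (hr : 0 < r) (hρ : Tendsto ρ l (𝓝 r)) (hf : Tendsto f l (𝓝 y)) :
    Tendsto (fun i => K (ρ i) (f i)) l (𝓝 (K r y)) := by
  have h1 : Tendsto (fun i => K (ρ i) y) l (𝓝 (K r y)) :=
    ((hK.cont y).continuousAt (Ioi_mem_nhds hr)).tendsto.comp hρ
  have h2 : Tendsto (fun i => K (ρ i) (f i - y)) l (𝓝 0) := by
    have h3 : Tendsto (fun i => A * ρ i ^ (-a) * ‖f i - y‖) l (𝓝 (A * r ^ (-a) * ‖y - y‖)) :=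
      ((hρ.rpow_const (Or.inl hr.ne')).const_mul A).mul (hf.sub_const y).norm
    rw [sub_self, norm_zero, mul_zero] at h3
    refine squeeze_zero_norm' ?_ h3
    filter_upwards [hρ.eventually (Ioi_mem_nhds hr)] with i hi using hK.norm_le _ hi _
  have h4 := h1.add h2
  rw [add_zero] at h4
  refine h4.congr fun i => ?_
  rw [← map_add, add_sub_cancel]

theorem continuousOn_integrand (hK : IsSingularKernel K A a) {t : ℝ} {F : ℝ → Y}
    (hF : ContinuousOn F (Icc 0 t)) : ContinuousOn (fun τ => K (t - τ) (F τ)) (Ioo 0 t) := by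
  intro τ hτ
  exact hK.tendsto (sub_pos.mpr hτ.2) ((continuous_const.sub continuous_id).continuousWithinAt)
    ((hF τ ⟨hτ.1.le, hτ.2.le⟩).mono Ioo_subset_Icc_self)

theorem intervalIntegrable (hK : IsSingularKernel K A a) {t : ℝ} (ht : 0 ≤ t) {F : ℝ → Y}
    (hF : ContinuousOn F (Icc 0 t)) :
    IntervalIntegrable (fun τ => K (t - τ) (F τ)) volume 0 t := by
  obtain ⟨M, hM0, hM⟩ := exists_norm_le hF
  have hg := (intervalIntegrable_sub_rpow hK.exp_lt_one t).const_mul (A * M)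
  rw [intervalIntegrable_iff_integrableOn_Ioo_of_le ht] at hg ⊢
  refine Integrable.mono' hg
    ((hK.continuousOn_integrand hF).aestronglyMeasurable measurableSet_Ioo) ?_
  refine (ae_restrict_iff' measurableSet_Ioo).mpr (Eventually.of_forall fun τ hτ => ?_)
  have hp : 0 ≤ (t - τ) ^ (-a) := Real.rpow_nonneg (sub_nonneg.mpr hτ.2.le) _
  calc ‖K (t - τ) (F τ)‖ ≤ A * (t - τ) ^ (-a) * ‖F τ‖ := hK.norm_le _ (sub_pos.mpr hτ.2) _
    _ ≤ A * (t - τ) ^ (-a) * M :=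
        mul_le_mul_of_nonneg_left (hM τ ⟨hτ.1.le, hτ.2.le⟩) (mul_nonneg hK.const_nonneg hp)
    _ = A * M * (t - τ) ^ (-a) := by ring

theorem norm_integral_le (hK : IsSingularKernel K A a) {t : ℝ} (ht : 0 ≤ t) {F : ℝ → Y} {M : ℝ}
    (hM : ∀ τ ∈ Icc 0 t, ‖F τ‖ ≤ M) :
    ‖∫ τ in (0 : ℝ)..t, K (t - τ) (F τ)‖ ≤ A * M * (t ^ (1 - a) / (1 - a)) := by
  rw [← integral_sub_rpow hK.exp_lt_one, ← intervalIntegral.integral_const_mul]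
  refine intervalIntegral.norm_integral_le_of_norm_le ht ?_
    ((intervalIntegrable_sub_rpow hK.exp_lt_one t).const_mul _)
  filter_upwards [Measure.ae_ne volume t] with τ hne hτ
  have hlt : τ < t := lt_of_le_of_ne hτ.2 hne
  have hp : 0 ≤ (t - τ) ^ (-a) := Real.rpow_nonneg (sub_nonneg.mpr hτ.2) _
  calc ‖K (t - τ) (F τ)‖ ≤ A * (t - τ) ^ (-a) * ‖F τ‖ := hK.norm_le _ (sub_pos.mpr hlt) _
    _ ≤ A * (t - τ) ^ (-a) * M :=
        mul_le_mul_of_nonneg_left (hM τ ⟨hτ.1.le, hτ.2⟩) (mul_nonneg hK.const_nonneg hp)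
    _ = A * M * (t - τ) ^ (-a) := by ring

/-- The bound of the Volterra integral in an exponentially weighted norm. Its constant
`Γ(1 - a) l^(a - 1)` is small for large `l`. -/
theorem norm_integral_le_exp (hK : IsSingularKernel K A a) {t l : ℝ} (ht : 0 ≤ t) (hl : 0 < l)
    {F : ℝ → Y} {M : ℝ} (hM0 : 0 ≤ M) (hM : ∀ τ ∈ Icc 0 t, ‖F τ‖ ≤ M * Real.exp (l * τ)) :
    ‖∫ τ in (0 : ℝ)..t, K (t - τ) (F τ)‖ ≤
      A * M * ((1 / l) ^ (1 - a) * Real.Gamma (1 - a)) * Real.exp (l * t) := by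
  have ha := hK.exp_lt_one
  set g : ℝ → ℝ := fun r => r ^ (1 - a - 1) * Real.exp (-(l * r)) with hg
  have hgi : ∫ r in Ioi (0 : ℝ), g r = (1 / l) ^ (1 - a) * Real.Gamma (1 - a) :=
    Real.integral_rpow_mul_exp_neg_mul_Ioi (by linarith) hl
  have hpos : 0 < (1 / l) ^ (1 - a) * Real.Gamma (1 - a) :=
    mul_pos (by positivity) (Real.Gamma_pos_of_pos (by linarith))
  have hint : IntegrableOn g (Ioi 0) := Integrable.of_integral_ne_zero (by rw [hgi]; exact hpos.ne')
  have hloc : IntervalIntegrable g volume 0 t := by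
    rw [intervalIntegrable_iff_integrableOn_Ioc_of_le ht]
    exact hint.mono_set Ioc_subset_Ioi_self
  have hloc' : IntervalIntegrable (fun τ => g (t - τ)) volume 0 t := by
    simpa using (hloc.comp_sub_left t).symm
  have hle : ∫ τ in (0 : ℝ)..t, g (t - τ) ≤ (1 / l) ^ (1 - a) * Real.Gamma (1 - a) := by
    rw [intervalIntegral.integral_comp_sub_left g t, sub_self, sub_zero, ← hgi,
      intervalIntegral.integral_of_le ht]
    refine setIntegral_mono_set hint ?_ (Eventually.of_forall Ioc_subset_Ioi_self)
    refine (ae_restrict_iff' measurableSet_Ioi).mpr (Eventually.of_forall fun r (hr : 0 < r) => ?_)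
    simp only [hg, Pi.zero_apply]; positivity
  have hstep : ‖∫ τ in (0 : ℝ)..t, K (t - τ) (F τ)‖ ≤
      ∫ τ in (0 : ℝ)..t, A * M * Real.exp (l * t) * g (t - τ) := by
    refine intervalIntegral.norm_integral_le_of_norm_le ht ?_ (hloc'.const_mul _)
    filter_upwards [Measure.ae_ne volume t] with τ hne hτ
    have hlt : τ < t := lt_of_le_of_ne hτ.2 hne
    have hp : 0 ≤ (t - τ) ^ (-a) := Real.rpow_nonneg (sub_nonneg.mpr hτ.2) _
    calc ‖K (t - τ) (F τ)‖ ≤ A * (t - τ) ^ (-a) * ‖F τ‖ := hK.norm_le _ (sub_pos.mpr hlt) _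
      _ ≤ A * (t - τ) ^ (-a) * (M * Real.exp (l * τ)) :=
          mul_le_mul_of_nonneg_left (hM τ ⟨hτ.1.le, hτ.2⟩) (mul_nonneg hK.const_nonneg hp)
      _ = A * M * Real.exp (l * t) * g (t - τ) := by
          have e : Real.exp (l * τ) = Real.exp (l * t) * Real.exp (-(l * (t - τ))) := by
            rw [← Real.exp_add]; congr 1; ring
          simp only [hg]
          rw [e, show 1 - a - 1 = -a by ring]
          ring
  refine hstep.trans ?_
  rw [intervalIntegral.integral_const_mul]
  have hc : 0 ≤ A * M * Real.exp (l * t) :=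
    mul_nonneg (mul_nonneg hK.const_nonneg hM0) (Real.exp_pos _).le
  calc _ ≤ A * M * Real.exp (l * t) * ((1 / l) ^ (1 - a) * Real.Gamma (1 - a)) :=
        mul_le_mul_of_nonneg_left hle hc
    _ = _ := by ring

theorem continuousOn_integral (hK : IsSingularKernel K A a) {T : ℝ} (hT : 0 ≤ T) {F : ℝ → Y}
    (hF : ContinuousOn F (Icc 0 T)) :
    ContinuousOn (fun t => ∫ τ in (0 : ℝ)..t, K (t - τ) (F τ)) (Icc 0 T) := by
  obtain ⟨F', hF', heq, hval⟩ := exists_continuous_eqOn hT hF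
  obtain ⟨M, hM0, hM⟩ := exists_norm_le hF
  have hM' : ∀ τ, ‖F' τ‖ ≤ M := fun τ => by
    obtain ⟨τ', hτ', e⟩ := hval τ
    rw [e]; exact hM τ' hτ'
  set f : ℝ → ℝ → X := fun t => (Ioi (0 : ℝ)).indicator fun r => K r (F' (t - r)) with hf
  have hcont : ∀ t, ContinuousOn (fun r => K r (F' (t - r))) (Ioi 0) := fun t r hr =>
    hK.tendsto hr continuousWithinAt_id
      (hF'.comp (continuous_const.sub continuous_id)).continuousWithinAt
  intro t₀ ht₀
  have key : ContinuousAt (fun p : ℝ × ℝ => ∫ r in (0 : ℝ)..p.2, f p.1 r) (t₀, t₀) := by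
    refine intervalIntegral.continuousAt_parametric_primitive_of_dominated
      (fun r => ‖A * M * r ^ (-a)‖) (-1) (T + 1) ?_ ?_ ?_ ?_ ⟨by norm_num, by linarith⟩
      ⟨by linarith [ht₀.1], by linarith [ht₀.2]⟩ (by simp)
    · intro t
      refine AEStronglyMeasurable.restrict ?_
      exact (aestronglyMeasurable_indicator_iff measurableSet_Ioi).mpr
        ((hcont t).aestronglyMeasurable measurableSet_Ioi)
    · refine Eventually.of_forall fun t => Eventually.of_forall fun r => ?_
      by_cases hr : r ∈ Ioi (0 : ℝ)
      · simp only [hf, indicator_of_mem hr]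
        have hp : 0 ≤ r ^ (-a) := Real.rpow_nonneg (le_of_lt hr) _
        calc ‖K r (F' (t - r))‖ ≤ A * r ^ (-a) * ‖F' (t - r)‖ := hK.norm_le _ hr _
          _ ≤ A * r ^ (-a) * M :=
              mul_le_mul_of_nonneg_left (hM' _) (mul_nonneg hK.const_nonneg hp)
          _ = A * M * r ^ (-a) := by ring
          _ ≤ _ := le_abs_self _
      · simp only [hf, indicator_of_notMem hr, norm_zero]
        positivity
    · exact ((intervalIntegral.intervalIntegrable_rpow'
        (by linarith [hK.exp_lt_one] : -1 < -a)).const_mul _).norm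
    · refine Eventually.of_forall fun r => ?_
      by_cases hr : r ∈ Ioi (0 : ℝ)
      · simp only [hf, indicator_of_mem hr]
        exact ((K r).continuous.comp (hF'.comp (continuous_id.sub continuous_const))).continuousAt
      · simp only [hf, indicator_of_notMem hr]
        exact continuousAt_const
  have key2 : ContinuousAt (fun t : ℝ => ∫ r in (0 : ℝ)..t, f t r) t₀ :=
    ContinuousAt.comp (f := fun t : ℝ => (t, t)) key
      (continuous_id.prodMk continuous_id).continuousAt
  refine key2.continuousWithinAt.congr_of_mem (fun t ht => ?_) ht₀
  have e := intervalIntegral.integral_comp_sub_left (a := 0) (b := t) (f t) t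
  rw [sub_self, sub_zero] at e
  rw [← e]
  refine intervalIntegral.integral_congr_ae ?_
  filter_upwards [Measure.ae_ne volume t] with τ hne hτ
  rw [uIoc_of_le ht.1] at hτ
  have hlt : τ < t := lt_of_le_of_ne hτ.2 hne
  simp only [hf]
  rw [indicator_of_mem (show t - τ ∈ Ioi (0 : ℝ) from sub_pos.mpr hlt), sub_sub_cancel,
    heq ⟨hτ.1.le, hτ.2.trans ht.2⟩]

/-- Two continuous solutions of the Volterra equation agree, whatever their size and however long
the time interval. -/
theorem solution_unique (hK : IsSingularKernel K A a) {T c : ℝ} {Q : X → Y} (hc : 0 ≤ c)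
    (hQ : ∀ x x', ‖Q x - Q x'‖ ≤ c * (‖x‖ + ‖x'‖) * ‖x - x'‖) {y G H : ℝ → X}
    (hG : ContinuousOn G (Icc 0 T)) (hH : ContinuousOn H (Icc 0 T))
    (eG : ∀ t ∈ Icc 0 T, G t = y t - ∫ τ in (0 : ℝ)..t, K (t - τ) (Q (G τ)))
    (eH : ∀ t ∈ Icc 0 T, H t = y t - ∫ τ in (0 : ℝ)..t, K (t - τ) (Q (H τ))) :
    EqOn G H (Icc 0 T) := by
  rcases lt_or_ge T 0 with hT | hT
  · intro t ht
    linarith [ht.1, ht.2]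
  have ha := hK.exp_lt_one
  have hQc := continuous_of_locally_lipschitz hQ
  have hQG : ContinuousOn (fun t => Q (G t)) (Icc 0 T) := hQc.comp_continuousOn hG
  have hQH : ContinuousOn (fun t => Q (H t)) (Icc 0 T) := hQc.comp_continuousOn hH
  obtain ⟨M, hM0, hM⟩ := exists_norm_le hG
  obtain ⟨M', hM0', hM'⟩ := exists_norm_le hH
  set B := A * (c * (M + M')) with hB
  have hB0 : 0 ≤ B := mul_nonneg hK.const_nonneg (by positivity)
  -- a weight `exp (-l t)` for which the equation of the difference is contractive
  obtain ⟨l, hl, hsmall⟩ : ∃ l : ℝ, 0 < l ∧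
      B * ((1 / l) ^ (1 - a) * Real.Gamma (1 - a)) ≤ 1 / 2 := by
    have h1 : Tendsto (fun l : ℝ => B * (l ^ (-(1 - a)) * Real.Gamma (1 - a))) atTop
        (𝓝 (B * (0 * Real.Gamma (1 - a)))) :=
      ((tendsto_rpow_neg_atTop (by linarith)).mul_const _).const_mul _
    rw [zero_mul, mul_zero] at h1
    obtain ⟨l, h2, h3⟩ := ((h1.eventually (Iic_mem_nhds (by norm_num : (0 : ℝ) < 1 / 2))).and
      (eventually_gt_atTop 0)).exists
    refine ⟨l, h3, ?_⟩
    rwa [one_div, Real.inv_rpow h3.le, ← Real.rpow_neg h3.le]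
  have hφ : ContinuousOn (fun t => Real.exp (-(l * t)) * ‖G t - H t‖) (Icc 0 T) :=
    (by fun_prop : Continuous fun t => Real.exp (-(l * t))).continuousOn.mul (hG.sub hH).norm
  obtain ⟨t₀, ht₀, hmax⟩ := isCompact_Icc.exists_isMaxOn (nonempty_Icc.mpr hT) hφ
  set N := Real.exp (-(l * t₀)) * ‖G t₀ - H t₀‖ with hN
  have hN0 : 0 ≤ N := by positivity
  have hdiff : ∀ τ ∈ Icc 0 T, ‖G τ - H τ‖ ≤ N * Real.exp (l * τ) := by
    intro τ hτ
    have h1 : Real.exp (-(l * τ)) * ‖G τ - H τ‖ ≤ N := hmax hτ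
    have h2 : Real.exp (-(l * τ)) * Real.exp (l * τ) = 1 := by rw [← Real.exp_add]; simp
    calc ‖G τ - H τ‖ = Real.exp (-(l * τ)) * ‖G τ - H τ‖ * Real.exp (l * τ) := by
          rw [mul_right_comm, h2, one_mul]
      _ ≤ _ := mul_le_mul_of_nonneg_right h1 (Real.exp_pos _).le
  have hsub : Icc 0 t₀ ⊆ Icc 0 T := Icc_subset_Icc_right ht₀.2
  have e : G t₀ - H t₀ = -∫ τ in (0 : ℝ)..t₀, K (t₀ - τ) (Q (G τ) - Q (H τ)) := by
    simp only [map_sub]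
    rw [intervalIntegral.integral_sub (hK.intervalIntegrable ht₀.1 (hQG.mono hsub))
      (hK.intervalIntegrable ht₀.1 (hQH.mono hsub)), eG t₀ ht₀, eH t₀ ht₀]
    abel
  have hle : ‖G t₀ - H t₀‖ ≤ A * (c * (M + M') * N) *
      ((1 / l) ^ (1 - a) * Real.Gamma (1 - a)) * Real.exp (l * t₀) := by
    rw [e, norm_neg]
    refine hK.norm_integral_le_exp ht₀.1 hl (by positivity) fun τ hτ => ?_
    have hτ' := hsub hτ
    calc ‖Q (G τ) - Q (H τ)‖ ≤ c * (‖G τ‖ + ‖H τ‖) * ‖G τ - H τ‖ := hQ _ _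
      _ ≤ c * (M + M') * (N * Real.exp (l * τ)) := by
          gcongr
          · exact hM τ hτ'
          · exact hM' τ hτ'
          · exact hdiff τ hτ'
      _ = _ := by ring
  have hN2 : N ≤ 1 / 2 * N := by
    have h2 : Real.exp (-(l * t₀)) * Real.exp (l * t₀) = 1 := by rw [← Real.exp_add]; simp
    calc N ≤ Real.exp (-(l * t₀)) * (A * (c * (M + M') * N) *
          ((1 / l) ^ (1 - a) * Real.Gamma (1 - a)) * Real.exp (l * t₀)) :=
          mul_le_mul_of_nonneg_left hle (Real.exp_pos _).le
      _ = (B * ((1 / l) ^ (1 - a) * Real.Gamma (1 - a))) * N *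
          (Real.exp (-(l * t₀)) * Real.exp (l * t₀)) := by rw [hB]; ring
      _ ≤ 1 / 2 * N := by
          rw [h2, mul_one]
          exact mul_le_mul_of_nonneg_right hsmall hN0
  have hNz : N = 0 := by linarith
  intro t ht
  have := hdiff t ht
  rw [hNz, zero_mul] at this
  exact sub_eq_zero.mp (norm_le_zero_iff.mp this)

/-- Existence by contraction in a ball of twice the radius of the data. -/
theorem exists_solution [CompleteSpace X] (hK : IsSingularKernel K A a) {T c R : ℝ} (hT : 0 ≤ T)
    {Q : X → Y} (hc : 0 ≤ c) (hR : 0 ≤ R)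
    (hQ : ∀ x x', ‖Q x - Q x'‖ ≤ c * (‖x‖ + ‖x'‖) * ‖x - x'‖) (hQ0 : Q 0 = 0) {y : ℝ → X}
    (hy : ContinuousOn y (Icc 0 T)) (hyR : ∀ t ∈ Icc 0 T, ‖y t‖ ≤ R)
    (hsmall : 4 * (A * c) * R * (T ^ (1 - a) / (1 - a)) < 1) :
    ∃ G : ℝ → X, ContinuousOn G (Icc 0 T) ∧
      ∀ t ∈ Icc 0 T, G t = y t - ∫ τ in (0 : ℝ)..t, K (t - τ) (Q (G τ)) := by
  have ha := hK.exp_lt_one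
  have hA := hK.const_nonneg
  have hQc : Continuous Q := continuous_of_locally_lipschitz hQ
  set θ := 4 * (A * c) * R * (T ^ (1 - a) / (1 - a)) with hθ
  have hθ0 : 0 ≤ θ := by
    have : 0 ≤ T ^ (1 - a) / (1 - a) := div_nonneg (Real.rpow_nonneg hT _) (by linarith)
    positivity
  have hmono : ∀ t ∈ Icc 0 T, t ^ (1 - a) / (1 - a) ≤ T ^ (1 - a) / (1 - a) := fun t ht =>
    div_le_div_of_nonneg_right (Real.rpow_le_rpow ht.1 ht.2 (by linarith)) (by linarith)
  -- continuous functions on `[0, T]`, extended to the line by constants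
  let ext : C(Icc 0 T, X) → ℝ → X := fun G => IccExtend hT G
  have hext : ∀ G : C(Icc 0 T, X), Continuous (ext G) := fun G => G.continuous.Icc_extend'
  have hQe : ∀ (G : C(Icc 0 T, X)) (t : ℝ), ContinuousOn (fun τ => Q (ext G τ)) (Icc 0 t) :=
    fun G t => (hQc.comp (hext G)).continuousOn
  have hnext : ∀ (G : C(Icc 0 T, X)) τ, ‖ext G τ‖ ≤ ‖G‖ := fun G τ => G.norm_coe_le_norm _
  have hsubext : ∀ (G H : C(Icc 0 T, X)) τ, ‖ext G τ - ext H τ‖ ≤ ‖G - H‖ := fun G H τ =>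
    (G - H).norm_coe_le_norm _
  let Φ : C(Icc 0 T, X) → C(Icc 0 T, X) := fun G =>
    ⟨(Icc 0 T).domRestrict fun t => y t - ∫ τ in (0 : ℝ)..t, K (t - τ) (Q (ext G τ)),
      continuousOn_iff_continuous_domRestrict.mp
        (hy.sub (hK.continuousOn_integral hT (hQc.comp (hext G)).continuousOn))⟩
  have hΦ : ∀ (G : C(Icc 0 T, X)) (t : Icc 0 T),
      Φ G t = y t - ∫ τ in (0 : ℝ)..t, K (t - τ) (Q (ext G τ)) := fun G t => rfl
  set S : Set C(Icc 0 T, X) := Metric.closedBall 0 (2 * R) with hS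
  have hmem : ∀ G, G ∈ S ↔ ‖G‖ ≤ 2 * R := fun G => by simp [hS]
  have hmaps : MapsTo Φ S S := by
    intro G hG
    rw [hmem] at hG ⊢
    refine (ContinuousMap.norm_le _ (by positivity)).mpr fun t => ?_
    rw [hΦ]
    have h1 : ‖∫ τ in (0 : ℝ)..t, K (t - τ) (Q (ext G τ))‖ ≤
        A * (c * (2 * R) * (2 * R)) * ((t : ℝ) ^ (1 - a) / (1 - a)) := by
      refine hK.norm_integral_le t.2.1 fun τ _ => ?_
      have h := hQ (ext G τ) 0
      rw [hQ0, sub_zero, sub_zero, norm_zero, add_zero] at h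
      refine h.trans ?_
      have := (hnext G τ).trans hG
      gcongr
    have h2 : A * (c * (2 * R) * (2 * R)) * ((t : ℝ) ^ (1 - a) / (1 - a)) ≤ θ * R := by
      calc _ ≤ A * (c * (2 * R) * (2 * R)) * (T ^ (1 - a) / (1 - a)) := by
            exact mul_le_mul_of_nonneg_left (hmono t t.2) (by positivity)
        _ = θ * R := by rw [hθ]; ring
    calc _ ≤ ‖y t‖ + ‖∫ τ in (0 : ℝ)..t, K (t - τ) (Q (ext G τ))‖ := norm_sub_le _ _
      _ ≤ R + θ * R := add_le_add (hyR t t.2) (h1.trans h2)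
      _ ≤ 2 * R := by nlinarith
  have hlip : ∀ G ∈ S, ∀ H ∈ S, ‖Φ G - Φ H‖ ≤ θ * ‖G - H‖ := by
    intro G hG H hH
    rw [hmem] at hG hH
    refine (ContinuousMap.norm_le _ (by positivity)).mpr fun t => ?_
    rw [ContinuousMap.sub_apply, hΦ, hΦ, sub_sub_sub_cancel_left, ← intervalIntegral.integral_sub
      (hK.intervalIntegrable t.2.1 (hQe H t)) (hK.intervalIntegrable t.2.1 (hQe G t))]
    simp only [← map_sub]
    have h1 : ‖∫ τ in (0 : ℝ)..t, K (t - τ) (Q (ext H τ) - Q (ext G τ))‖ ≤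
        A * (c * (2 * R + 2 * R) * ‖G - H‖) * ((t : ℝ) ^ (1 - a) / (1 - a)) := by
      refine hK.norm_integral_le t.2.1 fun τ _ => (hQ _ _).trans ?_
      have h3 := (hnext G τ).trans hG
      have h4 := (hnext H τ).trans hH
      have h5 := hsubext H G τ
      rw [norm_sub_rev H G] at h5
      gcongr
    refine h1.trans ?_
    calc _ ≤ A * (c * (2 * R + 2 * R) * ‖G - H‖) * (T ^ (1 - a) / (1 - a)) := by
          exact mul_le_mul_of_nonneg_left (hmono t t.2) (by positivity)
      _ = θ * ‖G - H‖ := by rw [hθ]; ring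
  have hcontr : ContractingWith ⟨θ, hθ0⟩ (hmaps.restrict Φ S S) := by
    refine ⟨by exact_mod_cast hsmall, LipschitzWith.of_dist_le_mul fun G H => ?_⟩
    rw [Subtype.dist_eq, Subtype.dist_eq, dist_eq_norm, dist_eq_norm]
    exact hlip G G.2 H H.2
  obtain ⟨G, -, hfix, -⟩ := ContractingWith.exists_fixedPoint'
    (Metric.isClosed_closedBall.isComplete : IsComplete S) hmaps hcontr
    (x := 0) (by rw [hmem, norm_zero]; positivity) (edist_ne_top _ _)
  refine ⟨ext G, (hext G).continuousOn, fun t ht => ?_⟩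
  have h := DFunLike.congr_fun hfix ⟨t, ht⟩
  rw [hΦ] at h
  rw [h]
  exact IccExtend_of_mem hT _ ht

end IsSingularKernel

end Volterra

/-! ### Symbols of the heat semigroup, of derivatives and of the Leray projector -/

/-- The symbol of the fractional heat semigroup. -/
def heatSym (α t : ℝ) (ξ : E3) : ℂ := (Real.exp (-t * (2 * Real.pi * ‖ξ‖) ^ α) : ℂ)

/-- The symbol of `∂ⱼ`. -/
def derivSym (j : Fin 3) (ξ : E3) : ℂ := 2 * Real.pi * Complex.I * (ξ j : ℂ)

/-- The symbol of the Riesz transform. -/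
def rieszSym (j : Fin 3) (ξ : E3) : ℂ := Complex.I * (ξ j : ℂ) / (‖ξ‖ : ℂ)

theorem norm_derivSym_le (j : Fin 3) (ξ : E3) : ‖derivSym j ξ‖ ≤ 2 * Real.pi * ‖ξ‖ := by
  have h : ‖((ξ j : ℝ) : ℂ)‖ ≤ ‖ξ‖ := by
    rw [Complex.norm_real]; exact PiLp.norm_apply_le ξ j
  have h2 : ‖derivSym j ξ‖ = 2 * Real.pi * ‖((ξ j : ℝ) : ℂ)‖ := by
    simp [derivSym, abs_of_pos Real.pi_pos]
  rw [h2]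
  gcongr

theorem continuous_derivSym (j : Fin 3) : Continuous (derivSym j) := by
  unfold derivSym; fun_prop

theorem derivSym_sub (j : Fin 3) (ξ η : E3) : derivSym j (ξ - η) = derivSym j ξ - derivSym j η := by
  simp [derivSym, mul_sub]

theorem norm_rieszSym_le (j : Fin 3) (ξ : E3) : ‖rieszSym j ξ‖ ≤ 1 := by
  have h : ‖((ξ j : ℝ) : ℂ)‖ ≤ ‖ξ‖ := by
    rw [Complex.norm_real]; exact PiLp.norm_apply_le ξ j
  rw [rieszSym, norm_div, norm_mul, Complex.norm_I, one_mul, Complex.norm_real ‖ξ‖, norm_norm]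
  exact div_le_one_of_le₀ h (norm_nonneg _)

theorem memLp_rieszSym (j : Fin 3) : MemLp (rieszSym j) ∞ volume := by
  refine memLp_top_of_bound ?_ 1 (Eventually.of_forall (norm_rieszSym_le j))
  have h1 : Continuous fun ξ : E3 => Complex.I * (ξ j : ℂ) := by fun_prop
  have h2 : Continuous fun ξ : E3 => ((‖ξ‖ : ℝ) : ℂ) := by fun_prop
  exact (h1.measurable.div h2.measurable).aestronglyMeasurable

theorem norm_heatSym (α t : ℝ) (ξ : E3) :
    ‖heatSym α t ξ‖ = Real.exp (-t * (2 * Real.pi * ‖ξ‖) ^ α) := by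
  rw [heatSym, Complex.norm_real, Real.norm_of_nonneg (Real.exp_pos _).le]

theorem norm_heatSym_le {α t : ℝ} (ht : 0 ≤ t) (ξ : E3) : ‖heatSym α t ξ‖ ≤ 1 := by
  rw [norm_heatSym]
  refine Real.exp_le_one_iff.mpr ?_
  have : 0 ≤ t * (2 * Real.pi * ‖ξ‖) ^ α := by positivity
  linarith

theorem continuous_heatSym {α : ℝ} (hα : 0 ≤ α) (t : ℝ) : Continuous (heatSym α t) := by
  have h : Continuous fun ξ : E3 => (2 * Real.pi * ‖ξ‖) ^ α :=
    Continuous.rpow_const (by fun_prop) fun _ => Or.inr hα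
  unfold heatSym
  exact Complex.continuous_ofReal.comp (Real.continuous_exp.comp (continuous_const.mul h))

theorem continuous_heatSym_left (α : ℝ) (ξ : E3) : Continuous fun t => heatSym α t ξ := by
  unfold heatSym; fun_prop

theorem memLp_heatSym {α t : ℝ} (hα : 0 ≤ α) (ht : 0 ≤ t) : MemLp (heatSym α t) ∞ volume :=
  memLp_top_of_bound (continuous_heatSym hα t).aestronglyMeasurable 1
    (Eventually.of_forall (norm_heatSym_le ht))

/-- The smoothing estimate of the fractional heat semigroup, for one derivative. -/
theorem mul_exp_neg_rpow_le {α t x : ℝ} (hα : 1 ≤ α) (ht : 0 < t) (hx : 0 ≤ x) :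
    x * Real.exp (-t * x ^ α) ≤ t ^ (-(1 / α)) := by
  set z := t ^ (1 / α) * x with hz
  have hz0 : 0 ≤ z := by positivity
  have hzα : z ^ α = t * x ^ α := by
    rw [hz, Real.mul_rpow (by positivity) hx, ← Real.rpow_mul ht.le, one_div,
      inv_mul_cancel₀ (by linarith), Real.rpow_one]
  have hle : z ≤ Real.exp (z ^ α) := by
    refine le_trans ?_ (Real.add_one_le_exp _)
    rcases le_total z 1 with h | h
    · linarith [Real.rpow_nonneg hz0 α]
    · linarith [Real.self_le_rpow_of_one_le h hα]
  have h1 : z * Real.exp (-t * x ^ α) ≤ 1 := by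
    rw [neg_mul, ← hzα, Real.exp_neg, ← div_eq_mul_inv]
    exact div_le_one_of_le₀ hle (Real.exp_pos _).le
  have ht' : t ^ (-(1 / α)) * t ^ (1 / α) = 1 := by
    rw [← Real.rpow_add ht]; simp
  calc x * Real.exp (-t * x ^ α) = t ^ (-(1 / α)) * (z * Real.exp (-t * x ^ α)) := by
        rw [hz, ← mul_assoc, ← mul_assoc, ht', one_mul]
    _ ≤ t ^ (-(1 / α)) * 1 := by gcongr
    _ = _ := mul_one _

/-- The symbol of `∂ⱼ e^{-t(-Δ)^{α/2}}`. -/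
def heatDerivSym (α t : ℝ) (j : Fin 3) (ξ : E3) : ℂ := heatSym α t ξ * derivSym j ξ

theorem norm_heatDerivSym_le {α t : ℝ} (hα : 1 ≤ α) (ht : 0 < t) (j : Fin 3) (ξ : E3) :
    ‖heatDerivSym α t j ξ‖ ≤ t ^ (-(1 / α)) := by
  rw [heatDerivSym, norm_mul, norm_heatSym, mul_comm]
  refine (mul_le_mul_of_nonneg_right (norm_derivSym_le j ξ) (Real.exp_pos _).le).trans ?_
  exact mul_exp_neg_rpow_le hα ht (by positivity)

theorem memLp_heatDerivSym {α t : ℝ} (hα : 1 ≤ α) (ht : 0 < t) (j : Fin 3) :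
    MemLp (heatDerivSym α t j) ∞ volume :=
  memLp_top_of_bound
    ((continuous_heatSym (by linarith) t).mul (continuous_derivSym j)).aestronglyMeasurable _
    (Eventually.of_forall (norm_heatDerivSym_le hα ht j))

/-- The symbol of `∂ⱼ (1 - Δ)^(-s/2)`. -/
def besselDerivSym (s : ℝ) (j : Fin 3) (ξ : E3) : ℂ := derivSym j ξ * invBracket s ξ

theorem norm_besselDerivSym_le {s : ℝ} (hs : 1 ≤ s) (j : Fin 3) (ξ : E3) :
    ‖besselDerivSym s j ξ‖ ≤ 1 := by
  rw [besselDerivSym, norm_mul, norm_invBracket, ← div_eq_mul_inv]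
  refine div_le_one_of_le₀ ((norm_derivSym_le j ξ).trans ?_) (bracket_pos s ξ).le
  set x := 2 * Real.pi * ‖ξ‖ with hx
  have hx0 : 0 ≤ x := by positivity
  calc x = (x ^ 2) ^ (1 / 2 : ℝ) := by rw [← Real.sqrt_eq_rpow, Real.sqrt_sq hx0]
    _ ≤ (1 + x ^ 2) ^ (1 / 2 : ℝ) := by gcongr; linarith
    _ ≤ (1 + x ^ 2) ^ (s / 2) :=
        Real.rpow_le_rpow_of_exponent_le (by nlinarith) (by linarith)

theorem memLp_besselDerivSym {s : ℝ} (hs : 1 ≤ s) (j : Fin 3) :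
    MemLp (besselDerivSym s j) ∞ volume :=
  memLp_top_of_bound ((continuous_derivSym j).mul (continuous_invBracket s)).aestronglyMeasurable 1
    (Eventually.of_forall (norm_besselDerivSym_le hs j))

/-- `ξ · (δᵢₖ - ξᵢ ξₖ / |ξ|²) = 0`: the range of the Leray projector is divergence free. At `ξ = 0`
both sides vanish. -/
theorem sum_besselDerivSym_mul_riesz (s : ℝ) (k : Fin 3) (ξ : E3) :
    ∑ i, besselDerivSym s i ξ * (rieszSym i ξ * rieszSym k ξ) = -besselDerivSym s k ξ := by
  by_cases h : ξ = 0
  · simp [h, besselDerivSym, derivSym]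
  have hn : ((‖ξ‖ : ℝ) : ℂ) ≠ 0 := by simpa using h
  have hsq : ((ξ 0 : ℝ) : ℂ) ^ 2 + (ξ 1 : ℂ) ^ 2 + (ξ 2 : ℂ) ^ 2 = ((‖ξ‖ : ℝ) : ℂ) ^ 2 := by
    have := EuclideanSpace.real_norm_sq_eq ξ
    rw [Fin.sum_univ_three] at this
    exact_mod_cast this.symm
  rw [Fin.sum_univ_three]
  simp only [besselDerivSym, derivSym, rieszSym]
  field_simp
  linear_combination (Complex.I ^ 2 * invBracket s ξ * (ξ k : ℂ)) * hsq +
    invBracket s ξ * (ξ k : ℂ) * ((‖ξ‖ : ℝ) : ℂ) ^ 2 * Complex.I_sq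

/-! ### The Leray projector and the Duhamel kernel on the Fourier side -/

/-- The `i`-th component of the Leray projector on the Fourier side. -/
def lerayL (i : Fin 3) : (Fin 3 → L2C) →L[ℂ] L2C :=
  ContinuousLinearMap.proj i +
    ∑ k, (mulL (rieszSym i)).comp ((mulL (rieszSym k)).comp (ContinuousLinearMap.proj k))

theorem lerayL_apply (i : Fin 3) (f : Fin 3 → L2C) :
    lerayL i f = f i + ∑ k, mulL (rieszSym i) (mulL (rieszSym k) (f k)) := by
  simp [lerayL]

theorem norm_lerayL_le (i : Fin 3) (f : Fin 3 → L2C) : ‖lerayL i f‖ ≤ 4 * ‖f‖ := by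
  rw [lerayL_apply]
  have h : ∀ k, ‖mulL (rieszSym i) (mulL (rieszSym k) (f k))‖ ≤ ‖f‖ := by
    intro k
    have h1 := norm_mulL_le (memLp_rieszSym i) (norm_rieszSym_le i) (mulL (rieszSym k) (f k))
    have h2 := norm_mulL_le (memLp_rieszSym k) (norm_rieszSym_le k) (f k)
    linarith [norm_le_pi_norm f k]
  have h3 : ‖∑ k, mulL (rieszSym i) (mulL (rieszSym k) (f k))‖ ≤ ∑ _k : Fin 3, ‖f‖ :=
    norm_sum_le_of_le _ fun k _ => h k
  simp only [Finset.sum_const, Finset.card_univ, Fintype.card_fin, nsmul_eq_mul] at h3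
  push_cast at h3
  linarith [norm_add_le (f i) (∑ k, mulL (rieszSym i) (mulL (rieszSym k) (f k))),
    norm_le_pi_norm f i]

theorem mulL_lerayL {m : E3 → ℂ} (hm : MemLp m ∞ volume) (i : Fin 3) (f : Fin 3 → L2C) :
    mulL m (lerayL i f) = lerayL i fun k => mulL m (f k) := by
  simp only [lerayL_apply, map_add, map_sum]
  congr 1
  refine Finset.sum_congr rfl fun k _ => ?_
  rw [mulL_comm hm (memLp_rieszSym i), mulL_comm hm (memLp_rieszSym k)]

theorem mulL_sum_symbol {ι : Type*} (S : Finset ι) {m : ι → E3 → ℂ}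
    (hm : ∀ i ∈ S, MemLp (m i) ∞ volume) (f : L2C) :
    mulL (fun ξ => ∑ i ∈ S, m i ξ) f = ∑ i ∈ S, mulL (m i) f := by
  refine (eq_mulL (memLp_finsetSum S hm) ?_).symm
  have h1 : ∀ i ∈ S, mulL (m i) f =ᵐ[volume] fun ξ => m i ξ * f ξ := fun i hi =>
    mulL_coeFn (hm i hi) f
  have h2 := (Filter.eventually_all_finset S).mpr h1
  filter_upwards [h2, Lp.coeFn_fun_finsetSum S fun i => mulL (m i) f] with ξ k1 k2
  rw [k2, Finset.sum_mul]
  exact Finset.sum_congr rfl k1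

/-- The divergence, composed with a Bessel potential. -/
def divL (s : ℝ) (f : Fin 3 → L2C) : L2C := ∑ i, mulL (besselDerivSym s i) (f i)

theorem mulL_divL {s : ℝ} (hs : 1 ≤ s) {m : E3 → ℂ} (hm : MemLp m ∞ volume) (f : Fin 3 → L2C) :
    mulL m (divL s f) = divL s fun i => mulL m (f i) := by
  simp only [divL, map_sum]
  exact Finset.sum_congr rfl fun i _ => mulL_comm hm (memLp_besselDerivSym hs i) _

/-- `div ℙ = 0`. -/
theorem divL_lerayL {s : ℝ} (hs : 1 ≤ s) (f : Fin 3 → L2C) : divL s (fun i => lerayL i f) = 0 := by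
  simp only [divL, lerayL_apply, map_add, map_sum, Finset.sum_add_distrib]
  rw [Finset.sum_comm (s := Finset.univ) (t := Finset.univ), ← Finset.sum_add_distrib]
  refine Finset.sum_eq_zero fun k _ => ?_
  have hd := memLp_besselDerivSym (s := s) hs
  have hr := memLp_rieszSym
  have h1 : ∀ i, mulL (besselDerivSym s i) (mulL (rieszSym i) (mulL (rieszSym k) (f k))) =
      mulL (fun ξ => besselDerivSym s i ξ * (rieszSym i ξ * rieszSym k ξ)) (f k) := fun i => by
    rw [mulL_mulL (hr i) (hr k), mulL_mulL (hd i) (memLp_mul (hr i) (hr k))]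
  simp only [h1]
  rw [← mulL_sum_symbol Finset.univ fun i _ => memLp_mul (hd i) (memLp_mul (hr i) (hr k))]
  simp only [sum_besselDerivSym_mul_riesz]
  have h2 : mulL (fun ξ => -besselDerivSym s k ξ) (f k) = -mulL (besselDerivSym s k) (f k) := by
    refine (eq_mulL (hd k).neg ?_).symm
    filter_upwards [mulL_coeFn (hd k) (f k), Lp.coeFn_neg (mulL (besselDerivSym s k) (f k))]
      with ξ k1 k2
    simp only [k2, Pi.neg_apply, k1, neg_mul]
  rw [h2, add_neg_cancel]

/-- The operator `q ↦ e^{-r(-Δ)^{α/2}} ℙ div q` on matrix fields, on the Fourier side; the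
divergence is taken in the first index of `q`. As a Fourier multiplier it commutes with the Bessel
potential, so that it acts on representatives of `H^s` functions by the same formula. Its values
for `r ≤ 0` have no meaning. -/
def duhamelKernel (α r : ℝ) : (Fin 3 → Fin 3 → L2C) →L[ℝ] (Fin 3 → L2C) :=
  ContinuousLinearMap.restrictScalars ℝ <| ContinuousLinearMap.pi fun i =>
    (lerayL i).comp <| ContinuousLinearMap.pi fun k => ∑ j, (mulL (heatDerivSym α r j)).comp
      ((ContinuousLinearMap.proj (R := ℂ) (φ := fun _ : Fin 3 => L2C) k).comp
        (ContinuousLinearMap.proj (R := ℂ) (φ := fun _ : Fin 3 => Fin 3 → L2C) j))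

theorem duhamelKernel_apply (α r : ℝ) (q : Fin 3 → Fin 3 → L2C) (i : Fin 3) :
    duhamelKernel α r q i = lerayL i fun k => ∑ j, mulL (heatDerivSym α r j) (q j k) := by
  simp only [duhamelKernel, ContinuousLinearMap.coe_restrictScalars', ContinuousLinearMap.coe_pi',
    ContinuousLinearMap.comp_apply]
  congr 1

theorem isSingularKernel_duhamelKernel {α : ℝ} (hα : 1 < α) :
    IsSingularKernel (duhamelKernel α) 12 (1 / α) where
  exp_lt_one := by rw [div_lt_one (by linarith)]; exact hα
  const_nonneg := by norm_num
  norm_le r hr q := by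
    have hp : 0 ≤ r ^ (-(1 / α)) := Real.rpow_nonneg hr.le _
    refine (pi_norm_le_iff_of_nonneg (by positivity)).mpr fun i => ?_
    rw [duhamelKernel_apply]
    refine (norm_lerayL_le i _).trans ?_
    have h : ‖fun k => ∑ j, mulL (heatDerivSym α r j) (q j k)‖ ≤ 3 * (r ^ (-(1 / α)) * ‖q‖) := by
      refine (pi_norm_le_iff_of_nonneg (by positivity)).mpr fun k => ?_
      have h1 : ‖∑ j, mulL (heatDerivSym α r j) (q j k)‖ ≤
          ∑ _j : Fin 3, r ^ (-(1 / α)) * ‖q‖ := by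
        refine norm_sum_le_of_le _ fun j _ => ?_
        refine (norm_mulL_le (memLp_heatDerivSym hα.le hr j)
          (norm_heatDerivSym_le hα.le hr j) _).trans ?_
        gcongr
        exact (norm_le_pi_norm (q j) k).trans (norm_le_pi_norm q j)
      simpa using h1
    linarith
  cont q := by
    intro r hr
    have hr : 0 < r := hr
    refine ContinuousAt.continuousWithinAt ?_
    refine continuousAt_pi.mpr fun i => ?_
    simp only [duhamelKernel_apply]
    refine (lerayL i).continuous.continuousAt.comp (continuousAt_pi.mpr fun k => ?_)
    refine tendsto_finsetSum _ fun j _ => ?_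
    have hev : ∀ᶠ t in 𝓝 r, r / 2 < t := eventually_gt_nhds (by linarith)
    refine tendsto_mulL (c := (r / 2) ^ (-(1 / α))) ?_ (memLp_heatDerivSym hα.le hr j) ?_ ?_ ?_ _
    · filter_upwards [hev] with t ht using memLp_heatDerivSym hα.le (by linarith) j
    · filter_upwards [hev] with t ht ξ
      refine (norm_heatDerivSym_le hα.le (by linarith) j ξ).trans ?_
      exact Real.rpow_le_rpow_of_nonpos (by linarith) ht.le
        (by rw [neg_nonpos]; exact div_nonneg zero_le_one (by linarith))
    · intro ξ
      refine (norm_heatDerivSym_le hα.le hr j ξ).trans ?_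
      exact Real.rpow_le_rpow_of_nonpos (by linarith) (by linarith)
        (by rw [neg_nonpos]; exact div_nonneg zero_le_one (by linarith))
    · intro ξ
      exact ((continuous_heatSym_left α ξ).tendsto r).mul_const _

/-- The derivative can be moved from the heat semigroup, where `r > 0` makes the product bounded,
to the Bessel potential, where `s ≥ 1` does. -/
theorem bessel_duhamelKernel {s α r : ℝ} (hs : 1 ≤ s) (hα : 1 ≤ α) (hr : 0 < r)
    (q : Fin 3 → Fin 3 → L2C) (i : Fin 3) :
    bessel s (duhamelKernel α r q i) =
      mulL (heatSym α r) (lerayL i fun k => ∑ j, mulL (besselDerivSym s j) (q j k)) := by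
  rw [duhamelKernel_apply, bessel, mulL_lerayL (memLp_top_invBracket (by linarith)),
    mulL_lerayL (memLp_heatSym (by linarith) hr.le)]
  congr 1
  ext1 k
  rw [map_sum, map_sum]
  refine Finset.sum_congr rfl fun j _ => ?_
  rw [mulL_mulL (memLp_top_invBracket (by linarith)) (memLp_heatDerivSym hα hr j),
    mulL_mulL (memLp_heatSym (by linarith) hr.le) (memLp_besselDerivSym hs j)]
  congr 2
  ext1 ξ
  rw [heatDerivSym, besselDerivSym]
  ring

theorem divL_duhamelKernel {s α r : ℝ} (hs : 1 ≤ s) (q : Fin 3 → Fin 3 → L2C) :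
    divL s (duhamelKernel α r q) = 0 := by
  have : duhamelKernel α r q =
      fun i => lerayL i fun k => ∑ j, mulL (heatDerivSym α r j) (q j k) :=
    funext (duhamelKernel_apply α r q)
  rw [this, divL_lerayL hs]

/-- The representative of `e^{-t(-Δ)^{α/2}} u₀`, if `G₀` represents `u₀`. -/
def linearFlow (α : ℝ) (G₀ : Fin 3 → L2C) (t : ℝ) : Fin 3 → L2C :=
  fun i => mulL (heatSym α t) (G₀ i)

theorem continuousOn_linearFlow {α : ℝ} (hα : 0 ≤ α) (G₀ : Fin 3 → L2C) (T : ℝ) :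
    ContinuousOn (linearFlow α G₀) (Icc 0 T) := by
  refine continuousOn_pi.mpr fun i t ht => ?_
  have hev : ∀ᶠ t' in 𝓝[Icc 0 T] t, 0 ≤ t' := by
    filter_upwards [self_mem_nhdsWithin] with t' ht' using ht'.1
  refine tendsto_mulL (c := 1) ?_ (memLp_heatSym hα ht.1) ?_ (norm_heatSym_le ht.1) ?_ _
  · filter_upwards [hev] with t' ht' using memLp_heatSym hα ht'
  · filter_upwards [hev] with t' ht' using norm_heatSym_le ht'
  · intro ξ
    exact ((continuous_heatSym_left α ξ).tendsto t).mono_left nhdsWithin_le_nhds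

theorem norm_linearFlow_le {α t : ℝ} (hα : 0 ≤ α) (ht : 0 ≤ t) (G₀ : Fin 3 → L2C) :
    ‖linearFlow α G₀ t‖ ≤ ‖G₀‖ := by
  refine (pi_norm_le_iff_of_nonneg (norm_nonneg _)).mpr fun i => ?_
  have h := norm_mulL_le (memLp_heatSym hα ht) (norm_heatSym_le ht) (G₀ i)
  rw [one_mul] at h
  exact h.trans (norm_le_pi_norm G₀ i)

/-- The representative of the tensor square `u ⊗ u`, if `G` represents `u`. -/
def tensorSq {s : ℝ} (hs : 3 / 2 < s) (G : Fin 3 → L2C) : Fin 3 → Fin 3 → L2C :=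
  fun j k => prodHs hs (G j) (G k)

/-- The local Lipschitz estimate of the nonlinearity that the contraction argument uses. -/
theorem norm_tensorSq_sub_le {s : ℝ} (hs : 3 / 2 < s) (G H : Fin 3 → L2C) :
    ‖tensorSq hs G - tensorSq hs H‖ ≤
      (algConst s ^ (1 / 2 : ℝ)).toReal * (‖G‖ + ‖H‖) * ‖G - H‖ := by
  refine (pi_norm_le_iff_of_nonneg (by positivity)).mpr fun j =>
    (pi_norm_le_iff_of_nonneg (by positivity)).mpr fun k => ?_
  refine (norm_prodHs_sub_le hs (G j) (H j) (G k) (H k)).trans ?_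
  rw [mul_assoc]
  refine mul_le_mul_of_nonneg_left ?_ ENNReal.toReal_nonneg
  have h1 := norm_le_pi_norm (G - H) j
  have h2 := norm_le_pi_norm (G - H) k
  rw [Pi.sub_apply] at h1 h2
  calc _ ≤ ‖G - H‖ * ‖G‖ + ‖H‖ * ‖G - H‖ := by
        gcongr
        · exact norm_le_pi_norm G k
        · exact norm_le_pi_norm H j
    _ = _ := by ring

theorem tensorSq_zero {s : ℝ} (hs : 3 / 2 < s) : tensorSq hs 0 = 0 := by
  ext1 j
  ext1 k
  have := norm_prodHs_le hs 0 0
  rw [norm_zero, mul_zero, mul_zero] at this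
  exact norm_le_zero_iff.mp this

/-! ### Functions in `H^s` and their representatives in `L²` -/

theorem toC_sub (f g : L2R) : toC (f - g) = toC f - toC g :=
  map_sub (Complex.ofRealCLM.compLpL 2 (volume : Measure E3)) f g

theorem toC_zero : toC 0 = 0 :=
  map_zero (Complex.ofRealCLM.compLpL 2 (volume : Measure E3))

theorem toC_coeFn (f : L2R) : toC f =ᵐ[volume] fun x => (f x : ℂ) :=
  Complex.ofRealCLM.coeFn_compLp f

theorem toC_injective : Function.Injective toC := by
  intro f g h
  refine Lp.ext ?_
  filter_upwards [toC_coeFn f, toC_coeFn g] with x h1 h2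
  rw [h, h2] at h1
  exact_mod_cast h1.symm

theorem fourier_injective {f g : L2C} (h : 𝓕 f = 𝓕 g) : f = g :=
  (Lp.fourierTransformₗᵢ E3 ℂ).injective h

theorem fourier_add (f g : L2C) : 𝓕 (f + g) = 𝓕 f + 𝓕 g :=
  map_add (Lp.fourierTransformₗᵢ E3 ℂ) f g

theorem fourier_zero : 𝓕 (0 : L2C) = 0 := map_zero (Lp.fourierTransformₗᵢ E3 ℂ)

theorem fourier_sum {ι : Type*} (S : Finset ι) (f : ι → L2C) :
    𝓕 (∑ i ∈ S, f i) = ∑ i ∈ S, 𝓕 (f i) :=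
  map_sum (Lp.fourierTransformₗᵢ E3 ℂ) f S

/-- The function `(1 - Δ)^(-s/2) 𝓕⁻¹ g`. For `s ≥ 0` this identifies `L²` with `H^s`, isometrically
for the norm of `H^s`. -/
def ofRep (s : ℝ) : L2C →L[ℂ] L2C :=
  ((Lp.fourierTransformₗᵢ E3 ℂ).symm : L2C →L[ℂ] L2C).comp (bessel s)

theorem fourier_ofRep (s : ℝ) (g : L2C) : 𝓕 (ofRep s g) = bessel s g :=
  (Lp.fourierTransformₗᵢ E3 ℂ).apply_symm_apply _

theorem eq_ofRep_iff {s : ℝ} {f g : L2C} : f = ofRep s g ↔ 𝓕 f = bessel s g :=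
  ⟨fun h => by rw [h, fourier_ofRep], fun h => fourier_injective (by rw [h, fourier_ofRep])⟩

theorem ofRep_injective {s : ℝ} (hs : 0 ≤ s) : Function.Injective (ofRep s) := fun g g' h =>
  bessel_injective hs (by rw [← fourier_ofRep, ← fourier_ofRep, h])

theorem bracket_mul_fourier {s : ℝ} (hs : 0 ≤ s) {f : L2R} {g : L2C} (h : toC f = ofRep s g) :
    (fun ξ : E3 => (((1 + (2 * Real.pi * ‖ξ‖) ^ 2) ^ (s / 2) : ℝ) : ℂ) *
      (𝓕 (toC f) : L2C) ξ) =ᵐ[volume] g := by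
  rw [eq_ofRep_iff.mp h]
  filter_upwards [bessel_coeFn hs g] with ξ hξ
  rw [hξ, ← mul_assoc]
  exact (congrArg (· * g ξ) (bracket_mul_invBracket s ξ)).trans (one_mul _)

/-- The `H^s` norm is the `L²` norm of the representative. -/
theorem hsENorm_eq {s : ℝ} (hs : 0 ≤ s) {f : L2R} {g : L2C} (h : toC f = ofRep s g) :
    hsENorm s f = ‖g‖ₑ := by
  rw [hsENorm, eLpNorm_congr_ae (bracket_mul_fourier hs h), Lp.enorm_def]

theorem memHs_of_eq_ofRep {s : ℝ} (hs : 0 ≤ s) {f : L2R} {g : L2C} (h : toC f = ofRep s g) :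
    MemHs s f := by
  rw [memHs_iff hs, hsENorm_eq hs h]
  exact enorm_lt_top

theorem exists_eq_ofRep {s : ℝ} (hs : 0 ≤ s) {f : L2R} (h : MemHs s f) :
    ∃ g, toC f = ofRep s g := by
  have hm : MemLp (fun ξ : E3 => (bracket s ξ : ℂ) * (𝓕 (toC f) : L2C) ξ) 2 volume :=
    ⟨(Complex.continuous_ofReal.comp (continuous_bracket s)).aestronglyMeasurable.mul
      (Lp.aestronglyMeasurable _), (memHs_iff hs f).mp h⟩
  refine ⟨hm.toLp _, eq_ofRep_iff.mpr (Lp.ext ?_)⟩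
  filter_upwards [bessel_coeFn hs (hm.toLp _), hm.coeFn_toLp] with ξ h1 h2
  rw [h1, h2, ← mul_assoc, mul_comm (invBracket s ξ), bracket_mul_invBracket, one_mul]

theorem contHs_iff {s T : ℝ} (hs : 0 ≤ s) {f : ℝ → L2R} {g : ℝ → L2C}
    (h : ∀ t ∈ Icc 0 T, toC (f t) = ofRep s (g t)) :
    ContHs s T f ↔ ContinuousOn g (Icc 0 T) := by
  have key : ∀ t₀ ∈ Icc 0 T, Tendsto (fun t => hsENorm s (f t - f t₀)) (𝓝[Icc 0 T] t₀) (𝓝 0) ↔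
      ContinuousWithinAt g (Icc 0 T) t₀ := by
    intro t₀ ht₀
    rw [ContinuousWithinAt, tendsto_iff_edist_tendsto_0]
    refine tendsto_congr' ?_
    filter_upwards [self_mem_nhdsWithin] with t ht
    rw [edist_eq_enorm_sub]
    exact hsENorm_eq hs (by rw [toC_sub, h t ht, h t₀ ht₀, map_sub])
  exact ⟨fun hf t ht => (key t ht).mp (hf.2 t ht),
    fun hg => ⟨fun t ht => memHs_of_eq_ofRep hs (h t ht), fun t ht => (key t ht).mpr (hg t ht)⟩⟩

theorem exists_rep_of_contHs {s T : ℝ} (hs : 0 ≤ s) {u : ℝ → Fin 3 → L2R}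
    (h : ∀ i, ContHs s T fun t => u t i) : ∃ G : ℝ → Fin 3 → L2C,
      ContinuousOn G (Icc 0 T) ∧ ∀ t ∈ Icc 0 T, ∀ i, toC (u t i) = ofRep s (G t i) := by
  choose g hg using fun (t : Icc 0 T) i => exists_eq_ofRep hs ((h i).1 t t.2)
  refine ⟨fun t i => if ht : t ∈ Icc 0 T then g ⟨t, ht⟩ i else 0, ?_, ?_⟩
  · refine continuousOn_pi.mpr fun i => (contHs_iff hs fun t ht => ?_).mp (h i)
    rw [dif_pos ht]
    exact hg ⟨t, ht⟩ i
  · intro t ht i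
    simp only [dif_pos ht]
    exact hg ⟨t, ht⟩ i

theorem norm_le_hsNorm {s : ℝ} (hs : 0 ≤ s) {u : Fin 3 → L2R} {G : Fin 3 → L2C}
    (h : ∀ i, toC (u i) = ofRep s (G i)) : ‖G‖ ≤ hsNorm s u := by
  refine (pi_norm_le_iff_of_nonneg (Real.sqrt_nonneg _)).mpr fun i => ?_
  refine Real.le_sqrt_of_sq_le ?_
  have e : ∀ i, (hsENorm s (u i)).toReal = ‖G i‖ := fun i => by
    rw [hsENorm_eq hs (h i), toReal_enorm]
  simp only [e]
  exact Finset.single_le_sum (f := fun i => ‖G i‖ ^ 2) (fun _ _ => sq_nonneg _) (Finset.mem_univ i)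

/-! ### The nonlinearity on the Fourier side -/

theorem fourier_partialD {s : ℝ} (hs : 1 ≤ s) (j : Fin 3) (g : L2C) :
    𝓕 (partialD j (ofRep s g)) = mulL (besselDerivSym s j) g := by
  have hae : (fun ξ : E3 => derivSym j ξ * (𝓕 (ofRep s g) : L2C) ξ) =ᵐ[volume]
      (mulL (besselDerivSym s j) g : L2C) := by
    rw [fourier_ofRep]
    filter_upwards [bessel_coeFn (by linarith : 0 ≤ s) g,
      mulL_coeFn (memLp_besselDerivSym hs j) g] with ξ h1 h2
    rw [h1, h2, ← mul_assoc, besselDerivSym]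
  have hm : MemLp (fun ξ : E3 => derivSym j ξ * (𝓕 (ofRep s g) : L2C) ξ) 2 volume :=
    (memLp_congr_ae hae).mpr (Lp.memLp _)
  have e : partialD j (ofRep s g) = 𝓕⁻ (hm.toLp _) := dif_pos hm
  rw [e, FourierTransform.fourier_fourierInv_eq]
  exact Lp.ext (hm.coeFn_toLp.trans hae)

theorem fourier_mulL2 {s : ℝ} (hs : 3 / 2 < s) (g f : L2C) :
    𝓕 (mulL2 (ofRep s g) f) = convL (bessel s g) (integrable_bessel hs g) (𝓕 f) := by
  have h := mulL2_fourierInv (bessel s g) (integrable_bessel hs g) (𝓕 f)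
  rw [FourierTransform.fourierInv_fourier_eq] at h
  have e : ofRep s g = 𝓕⁻ (bessel s g) := rfl
  rw [e, h, FourierTransform.fourier_fourierInv_eq]

theorem mulL2_ofRep {s : ℝ} (hs : 3 / 2 < s) (g h : L2C) :
    mulL2 (ofRep s g) (ofRep s h) = ofRep s (prodHs hs g h) := by
  rw [eq_ofRep_iff, fourier_mulL2 hs, fourier_ofRep, convL_bessel]

/-- Leibniz' rule, on the Fourier side. -/
theorem conv_besselDeriv {s : ℝ} (hs : 3 / 2 < s) (j : Fin 3) (g h : L2C) (ξ : E3) :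
    conv (bessel s g) (mulL (besselDerivSym s j) h) ξ =
      derivSym j ξ * conv (bessel s g) (bessel s h) ξ -
        conv (mulL (besselDerivSym s j) g) (bessel s h) ξ := by
  have hD : ∀ g : L2C, mulL (besselDerivSym s j) g =ᵐ[volume]
      fun ξ => derivSym j ξ * bessel s g ξ := by
    intro g
    filter_upwards [bessel_coeFn (by linarith : 0 ≤ s) g,
      mulL_coeFn (memLp_besselDerivSym (by linarith : 1 ≤ s) j) g] with ξ h1 h2
    rw [h1, h2, ← mul_assoc, besselDerivSym]
  have hm : ∀ g : L2C, MemLp (fun ξ => derivSym j ξ * bessel s g ξ) 2 volume := fun g =>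
    (memLp_congr_ae (hD g)).mp (Lp.memLp _)
  rw [conv_congr (EventuallyEq.refl _ _) (hD h), conv_congr (hD g) (EventuallyEq.refl _ _),
    conv_apply, conv_apply, conv_apply, ← integral_const_mul, ← integral_sub
      ((integrable_conv_integrand (Lp.memLp _) (Lp.memLp _) ξ).const_mul _)
      (integrable_conv_integrand (hm g) (Lp.memLp _) ξ)]
  refine integral_congr_ae (Eventually.of_forall fun η => ?_)
  simp only [derivSym_sub]
  ring

theorem sum_conv_left {ι : Type*} (S : Finset ι) (f : ι → L2C) (b : L2C) (ξ : E3) :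
    ∑ j ∈ S, conv (f j) b ξ = conv (∑ j ∈ S, f j : L2C) b ξ := by
  rw [conv_congr (Lp.coeFn_fun_finsetSum S f) (EventuallyEq.refl _ _)]
  simp only [conv_apply, Finset.sum_mul]
  exact (integral_finsetSum S fun j _ =>
    integrable_conv_integrand (Lp.memLp (f j)) (Lp.memLp b) ξ).symm

/-- For divergence free fields `(u · ∇) u = div (u ⊗ u)`. -/
theorem fourier_convection {s : ℝ} (hs : 3 / 2 < s) {u : Fin 3 → L2R} {G : Fin 3 → L2C}
    (h : ∀ i, toC (u i) = ofRep s (G i)) (hdiv : divL s G = 0) (i : Fin 3) :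
    𝓕 (convection u i) = ∑ j, mulL (besselDerivSym s j) (tensorSq hs G j i) := by
  have hs1 : 1 ≤ s := by linarith
  rw [convection, fourier_sum]
  have e : ∀ j, 𝓕 (mulL2 (toC (u j)) (partialD j (toC (u i)))) =
      convL (bessel s (G j)) (integrable_bessel hs (G j)) (mulL (besselDerivSym s j) (G i)) := by
    intro j
    rw [h, h, fourier_mulL2 hs, fourier_partialD hs1]
  simp only [e]
  have h0 : ∀ ξ, ∑ j, conv (mulL (besselDerivSym s j) (G j)) (bessel s (G i)) ξ = 0 := by
    intro ξ
    rw [sum_conv_left]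
    have hz : (∑ j, mulL (besselDerivSym s j) (G j) : L2C) = 0 := hdiv
    rw [hz, conv_congr (Lp.coeFn_zero ℂ 2 volume) (EventuallyEq.refl _ _)]
    simp [conv_apply]
  refine Lp.ext ?_
  have a1 := Filter.eventually_all.mpr fun j =>
    convL_coeFn (bessel s (G j)) (integrable_bessel hs (G j)) (mulL (besselDerivSym s j) (G i))
  have a2 := Filter.eventually_all.mpr fun j =>
    mulL_coeFn (memLp_besselDerivSym hs1 j) (tensorSq hs G j i)
  have a3 := Filter.eventually_all.mpr fun j => prodHs_coeFn hs (G j) (G i)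
  filter_upwards [a1, a2, a3, Lp.coeFn_fun_finsetSum Finset.univ fun j =>
      convL (bessel s (G j)) (integrable_bessel hs (G j)) (mulL (besselDerivSym s j) (G i)),
    Lp.coeFn_fun_finsetSum Finset.univ fun j => mulL (besselDerivSym s j) (tensorSq hs G j i)]
    with ξ k1 k2 k3 k4 k5
  rw [k4, k5]
  have e2 : ∀ j, (mulL (besselDerivSym s j) (tensorSq hs G j i) : L2C) ξ =
      derivSym j ξ * conv (bessel s (G j)) (bessel s (G i)) ξ := by
    intro j
    rw [k2 j, tensorSq, k3 j, besselDerivSym]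
    linear_combination (derivSym j ξ * conv (bessel s (G j)) (bessel s (G i)) ξ) *
      bracket_mul_invBracket s ξ
  simp only [k1, e2, conv_besselDeriv hs]
  rw [Finset.sum_sub_distrib, h0, sub_zero]

theorem divFree_iff {s : ℝ} (hs : 1 ≤ s) {u : Fin 3 → L2R} {G : Fin 3 → L2C}
    (h : ∀ i, toC (u i) = ofRep s (G i)) : DivFree u ↔ divL s G = 0 := by
  have e : 𝓕 (∑ j, partialD j (toC (u j))) = divL s G := by
    rw [fourier_sum, divL]
    exact Finset.sum_congr rfl fun j _ => by rw [h, fourier_partialD hs]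
  rw [DivFree, ← e]
  exact ⟨fun h => by rw [h, fourier_zero], fun h => fourier_injective (by rw [h, fourier_zero])⟩

theorem fourier_riesz_riesz (i j : Fin 3) (f : L2C) :
    𝓕 (riesz i (riesz j f)) = mulL (rieszSym i) (mulL (rieszSym j) (𝓕 f)) := by
  have h : ∀ i (f : L2C), 𝓕 (riesz i f) = mulL (rieszSym i) (𝓕 f) := fun i f =>
    fourier_fourierMul (memLp_rieszSym i) f
  rw [h, h]

theorem fourier_leray (f : Fin 3 → L2C) (i : Fin 3) :
    𝓕 (leray f i) = lerayL i fun k => 𝓕 (f k) := by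
  rw [leray, fourier_add, fourier_sum, lerayL_apply]
  congr 1
  exact Finset.sum_congr rfl fun k _ => fourier_riesz_riesz i k (f k)

theorem fourier_heatSemigroup {α t : ℝ} (hα : 0 ≤ α) (ht : 0 ≤ t) (f : L2C) :
    𝓕 (heatSemigroup α t f) = mulL (heatSym α t) (𝓕 f) :=
  fourier_fourierMul (memLp_heatSym hα ht) f

/-! ### Mild solutions and the Volterra equation -/

theorem heatSemigroup_leray_convection {s α r : ℝ} (hs : 3 / 2 < s) (hα : 1 ≤ α) (hr : 0 < r)
    {u : Fin 3 → L2R} {G : Fin 3 → L2C} (h : ∀ i, toC (u i) = ofRep s (G i))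
    (hdiv : divL s G = 0) (i : Fin 3) :
    heatSemigroup α r (leray (convection u) i) =
      ofRep s (duhamelKernel α r (tensorSq hs G) i) := by
  rw [eq_ofRep_iff, fourier_heatSemigroup (by linarith) hr.le, fourier_leray,
    bessel_duhamelKernel (by linarith) hα hr]
  simp only [fourier_convection hs h hdiv]

theorem heatSemigroup_ofRep {s α t : ℝ} (hs : 0 ≤ s) (hα : 0 ≤ α) (ht : 0 ≤ t) (G : Fin 3 → L2C)
    (i : Fin 3) : heatSemigroup α t (ofRep s (G i)) = ofRep s (linearFlow α G t i) := by
  rw [eq_ofRep_iff, fourier_heatSemigroup hα ht, fourier_ofRep]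
  exact mulL_comm (memLp_heatSym hα ht) (memLp_top_invBracket hs) _

theorem intervalIntegrable_clm_comp {X Y : Type*} [NormedAddCommGroup X] [NormedSpace ℝ X]
    [NormedAddCommGroup Y] [NormedSpace ℝ Y] (L : X →L[ℝ] Y) {f : ℝ → X} {a b : ℝ}
    (hf : IntervalIntegrable f volume a b) : IntervalIntegrable (fun τ => L (f τ)) volume a b :=
  ⟨L.integrable_comp hf.1, L.integrable_comp hf.2⟩

/-- For divergence free fields, mild solutions in `H^s` are the solutions of the Volterra equation
for the representatives. -/
theorem isMildSolution_iff {s α T : ℝ} (hs : 3 / 2 < s) (hα : 1 < α) {u₀ : Fin 3 → L2R}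
    {G₀ : Fin 3 → L2C} (h₀ : ∀ i, toC (u₀ i) = ofRep s (G₀ i)) {u : ℝ → Fin 3 → L2R}
    {G : ℝ → Fin 3 → L2C} (hG : ContinuousOn G (Icc 0 T))
    (h : ∀ t ∈ Icc 0 T, ∀ i, toC (u t i) = ofRep s (G t i))
    (hdiv : ∀ t ∈ Icc 0 T, divL s (G t) = 0) :
    IsMildSolution α T u₀ u ↔ ∀ t ∈ Icc 0 T, G t = linearFlow α G₀ t -
      ∫ τ in (0 : ℝ)..t, duhamelKernel α (t - τ) (tensorSq hs (G τ)) := by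
  have hs0 : 0 ≤ s := by linarith
  have hα0 : 0 ≤ α := by linarith
  have hQ : Continuous (tensorSq hs) :=
    continuous_of_locally_lipschitz (norm_tensorSq_sub_le hs)
  -- the map to the `i`-th component in physical space
  let L : Fin 3 → (Fin 3 → L2C) →L[ℝ] L2C := fun i =>
    ((ofRep s).comp (ContinuousLinearMap.proj (R := ℂ) (φ := fun _ : Fin 3 => L2C)
      i)).restrictScalars ℝ
  have hL : ∀ i F, L i F = ofRep s (F i) := fun i F => rfl
  have hint : ∀ t ∈ Icc 0 T, IntervalIntegrable
      (fun τ => duhamelKernel α (t - τ) (tensorSq hs (G τ))) volume 0 t := fun t ht =>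
    (isSingularKernel_duhamelKernel hα).intervalIntegrable ht.1
      ((hQ.comp_continuousOn hG).mono (Icc_subset_Icc_right ht.2))
  have hae : ∀ t ∈ Icc 0 T, ∀ i, ∀ᵐ τ, τ ∈ uIoc 0 t →
      L i (duhamelKernel α (t - τ) (tensorSq hs (G τ))) =
        heatSemigroup α (t - τ) (leray (convection (u τ)) i) := by
    intro t ht i
    filter_upwards [Measure.ae_ne volume t] with τ hne hτ
    rw [uIoc_of_le ht.1] at hτ
    have hτT : τ ∈ Icc 0 T := ⟨hτ.1.le, hτ.2.trans ht.2⟩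
    exact (heatSemigroup_leray_convection hs hα.le (sub_pos.mpr (lt_of_le_of_ne hτ.2 hne))
      (h τ hτT) (hdiv τ hτT) i).symm
  have hI : ∀ t ∈ Icc 0 T, ∀ i, ∫ τ in (0 : ℝ)..t,
      heatSemigroup α (t - τ) (leray (convection (u τ)) i) =
        L i (∫ τ in (0 : ℝ)..t, duhamelKernel α (t - τ) (tensorSq hs (G τ))) := by
    intro t ht i
    rw [← (L i).intervalIntegral_comp_comm (hint t ht)]
    exact (intervalIntegral.integral_congr_ae (hae t ht i)).symm
  constructor
  · intro hm t ht
    refine funext fun i => ofRep_injective hs0 ?_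
    have h1 := (hm t ht i).2
    rw [hI t ht i, h t ht i, h₀, heatSemigroup_ofRep hs0 hα0 ht.1, hL, ← map_sub] at h1
    exact h1
  · intro hv t ht i
    refine ⟨(intervalIntegrable_clm_comp (L i) (hint t ht)).congr_ae
      ((ae_restrict_iff' measurableSet_uIoc).mpr (hae t ht i)), ?_⟩
    rw [hI t ht i, h t ht i, h₀, heatSemigroup_ofRep hs0 hα0 ht.1, hL, ← map_sub]
    exact congrArg (fun F : Fin 3 → L2C => ofRep s (F i)) (hv t ht)

/-- Mild solutions stay divergence free, because both terms of Duhamel's formula are. No regularity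
beyond `L²` is needed for the nonlinear term. -/
theorem divL_eq_zero_of_isMildSolution {s α T : ℝ} (hs : 1 ≤ s) (hα : 0 ≤ α) {u₀ : Fin 3 → L2R}
    {G₀ : Fin 3 → L2C} (h₀ : ∀ i, toC (u₀ i) = ofRep s (G₀ i)) (hdiv₀ : divL s G₀ = 0)
    {u : ℝ → Fin 3 → L2R} (hu : IsMildSolution α T u₀ u) {t : ℝ} (ht : t ∈ Icc 0 T)
    {G : Fin 3 → L2C} (h : ∀ i, toC (u t i) = ofRep s (G i)) : divL s G = 0 := by
  have hs0 : 0 ≤ s := by linarith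
  let L : Fin 3 → L2C →L[ℝ] L2C := fun i =>
    ((mulL (besselDerivSym s i)).comp
      ((Lp.fourierTransformₗᵢ E3 ℂ) : L2C →L[ℂ] L2C)).restrictScalars ℝ
  have hL : ∀ i f, L i f = mulL (besselDerivSym s i) (𝓕 f) := fun i f => rfl
  have hdivb : ∀ F : Fin 3 → L2C, ∑ i, L i (ofRep s (F i)) = bessel s (divL s F) := by
    intro F
    simp only [hL, fourier_ofRep]
    exact (mulL_divL hs (memLp_top_invBracket hs0) F).symm
  have h1 : ∑ i, L i (toC (u t i)) = ∑ i, L i (heatSemigroup α t (toC (u₀ i))) -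
      ∑ i, L i (∫ τ in (0 : ℝ)..t, heatSemigroup α (t - τ) (leray (convection (u τ)) i)) := by
    rw [← Finset.sum_sub_distrib]
    exact Finset.sum_congr rfl fun i _ => by rw [(hu t ht i).2, map_sub]
  have h2 : ∑ i, L i (heatSemigroup α t (toC (u₀ i))) = 0 := by
    have e : ∀ i, L i (heatSemigroup α t (toC (u₀ i))) = L i (ofRep s (linearFlow α G₀ t i)) :=
      fun i => by rw [h₀, heatSemigroup_ofRep hs0 hα ht.1]
    simp only [e]
    rw [hdivb]
    have e2 : divL s (linearFlow α G₀ t) = 0 := by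
      have := mulL_divL hs (memLp_heatSym hα ht.1) G₀
      rw [hdiv₀, map_zero] at this
      exact this.symm
    rw [e2, map_zero]
  have h3 : ∑ i, L i (∫ τ in (0 : ℝ)..t,
      heatSemigroup α (t - τ) (leray (convection (u τ)) i)) = 0 := by
    have e : ∀ i, L i (∫ τ in (0 : ℝ)..t,
        heatSemigroup α (t - τ) (leray (convection (u τ)) i)) =
        ∫ τ in (0 : ℝ)..t, L i (heatSemigroup α (t - τ) (leray (convection (u τ)) i)) := fun i =>
      ((L i).intervalIntegral_comp_comm (hu t ht i).1).symm
    simp only [e]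
    rw [← intervalIntegral.integral_finsetSum fun i _ =>
      intervalIntegrable_clm_comp (L i) (hu t ht i).1]
    refine (intervalIntegral.integral_congr fun τ hτ => ?_).trans intervalIntegral.integral_zero
    rw [uIcc_of_le ht.1] at hτ
    have hr : 0 ≤ t - τ := sub_nonneg.mpr hτ.2
    simp only [hL, fourier_heatSemigroup hα hr, fourier_leray,
      mulL_lerayL (memLp_heatSym hα hr)]
    exact divL_lerayL hs _
  rw [h2, h3, sub_zero] at h1
  simp only [h] at h1
  rw [hdivb] at h1
  exact bessel_injective hs0 (by rw [h1, map_zero])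

/-! ### Real-valued functions -/

/-- Complex conjugation on `L²`. -/
def conjL : L2C →L[ℝ] L2C := (Complex.conjCLE : ℂ →L[ℝ] ℂ).compLpL 2 volume

/-- The operator `f ↦ conj (f (-·))`, which is complex conjugation on the Fourier side. -/
def conjNeg : L2C →L[ℝ] L2C :=
  conjL.comp (Lp.compMeasurePreservingₗᵢ ℝ (Neg.neg : E3 → E3)
    (Measure.measurePreserving_neg volume)).toContinuousLinearMap

theorem conjL_coeFn (f : L2C) : conjL f =ᵐ[volume] fun x => (starRingEnd ℂ) (f x) :=
  (Complex.conjCLE : ℂ →L[ℝ] ℂ).coeFn_compLpL f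

theorem ae_comp_neg {f g : E3 → ℂ} (h : f =ᵐ[volume] g) :
    (fun ξ => f (-ξ)) =ᵐ[volume] fun ξ => g (-ξ) :=
  (Measure.measurePreserving_neg (volume : Measure E3)).quasiMeasurePreserving.ae_eq_comp h

theorem conjNeg_coeFn (f : L2C) : conjNeg f =ᵐ[volume] fun ξ => (starRingEnd ℂ) (f (-ξ)) := by
  have h1 := conjL_coeFn (Lp.compMeasurePreserving (Neg.neg : E3 → E3)
    (Measure.measurePreserving_neg volume) f)
  have h2 := Lp.coeFn_compMeasurePreserving f (Measure.measurePreserving_neg (volume : Measure E3))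
  refine EventuallyEq.trans h1 ?_
  filter_upwards [h2] with ξ k
  rw [k]
  rfl

theorem conjNeg_mulL {m : E3 → ℂ} (hm : MemLp m ∞ volume)
    (hherm : ∀ ξ, (starRingEnd ℂ) (m (-ξ)) = m ξ) (f : L2C) :
    conjNeg (mulL m f) = mulL m (conjNeg f) := by
  refine eq_mulL hm ?_
  filter_upwards [conjNeg_coeFn (mulL m f), ae_comp_neg (mulL_coeFn hm f), conjNeg_coeFn f]
    with ξ h1 h2 h3
  rw [h1, h2, h3, map_mul, hherm]

theorem fourierInv_conjNeg (f : L2C) : 𝓕⁻ (conjNeg f) = conjL (𝓕⁻ f) := by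
  refine DenseRange.induction_on (p := fun f : L2C => 𝓕⁻ (conjNeg f) = conjL (𝓕⁻ f))
    (SchwartzMap.denseRange_toLpCLM (p := 2) ENNReal.ofNat_ne_top) f ?_ ?_
  · refine isClosed_eq ?_ ?_
    · exact (Lp.fourierTransformₗᵢ E3 ℂ).symm.continuous.comp conjNeg.continuous
    · exact conjL.continuous.comp (Lp.fourierTransformₗᵢ E3 ℂ).symm.continuous
  intro φ
  have e0 : (SchwartzMap.toLpCLM ℝ ℂ 2 volume φ : L2C) = φ.toLp 2 := rfl
  rw [e0]
  set ψ : E3 → ℂ := fun ξ => (starRingEnd ℂ) (φ (-ξ)) with hψ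
  have hae : conjNeg (φ.toLp 2) =ᵐ[volume] ψ := by
    filter_upwards [conjNeg_coeFn (φ.toLp 2), ae_comp_neg (φ.coeFn_toLp 2)] with ξ h1 h2
    rw [h1, h2]
  have h2 : MemLp ψ 2 volume := (memLp_congr_ae hae).mp (Lp.memLp _)
  have h1 : Integrable ψ volume := by
    refine Integrable.mono' (g := fun ξ => ‖φ (-ξ)‖) φ.integrable.comp_neg.norm h2.1
      (Eventually.of_forall fun ξ => ?_)
    simp [hψ]
  have e1 : conjNeg (φ.toLp 2) = h2.toLp ψ := Lp.ext (hae.trans h2.coeFn_toLp.symm)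
  rw [e1, SchwartzMap.toLp_fourierInv_eq]
  refine Lp.ext ?_
  filter_upwards [fourierInv_toLp_ae h1 h2, conjL_coeFn ((𝓕⁻ φ).toLp 2),
    (𝓕⁻ φ).coeFn_toLp 2] with x k1 k2 k3
  rw [k1, k2, k3, SchwartzMap.fourierInv_coe, Real.fourierInv_eq', Real.fourierInv_eq',
    ← integral_conj, ← integral_neg_eq_self]
  refine integral_congr_ae (Eventually.of_forall fun ξ => ?_)
  simp only [hψ, smul_eq_mul, map_mul, ← Complex.exp_conj, inner_neg_left]
  simp [map_ofNat]

theorem conjL_ofRep {s : ℝ} (hs : 0 ≤ s) (g : L2C) : conjL (ofRep s g) = ofRep s (conjNeg g) := by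
  have e : ∀ g, ofRep s g = 𝓕⁻ (bessel s g) := fun g => rfl
  rw [e, e, ← fourierInv_conjNeg, bessel, conjNeg_mulL (memLp_top_invBracket hs)]
  intro ξ
  rw [invBracket, invBracket, Complex.conj_ofReal, bracket, bracket, norm_neg]

theorem conjL_toC (f : L2R) : conjL (toC f) = toC f := by
  refine Lp.ext ?_
  filter_upwards [conjL_coeFn (toC f), toC_coeFn f] with x h1 h2
  rw [h1, h2, Complex.conj_ofReal]

/-- The real part of an `L²` function. -/
def reL (f : L2C) : L2R := Complex.reCLM.compLp f

theorem toC_reL {f : L2C} (h : conjL f = f) : toC (reL f) = f := by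
  refine Lp.ext ?_
  have h0 := conjL_coeFn f
  rw [h] at h0
  filter_upwards [toC_coeFn (reL f), Complex.reCLM.coeFn_compLp f, h0] with x h1 h2 h3
  rw [h1, reL, h2]
  exact Complex.conj_eq_iff_re.mp h3.symm

/-- A representative with Hermitian symmetry stands for a real-valued function. -/
theorem toC_reL_ofRep {s : ℝ} (hs : 0 ≤ s) {g : L2C} (h : conjNeg g = g) :
    toC (reL (ofRep s g)) = ofRep s g :=
  toC_reL (by rw [conjL_ofRep hs, h])

theorem conjNeg_eq_of_toC {s : ℝ} (hs : 0 ≤ s) {f : L2R} {g : L2C} (h : toC f = ofRep s g) :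
    conjNeg g = g :=
  ofRep_injective hs (by rw [← conjL_ofRep hs, ← h, conjL_toC])

theorem conj_heatSym (α t : ℝ) (ξ : E3) :
    (starRingEnd ℂ) (heatSym α t (-ξ)) = heatSym α t ξ := by
  rw [heatSym, heatSym, Complex.conj_ofReal, norm_neg]

theorem conj_derivSym (j : Fin 3) (ξ : E3) :
    (starRingEnd ℂ) (derivSym j (-ξ)) = derivSym j ξ := by
  simp [derivSym, map_ofNat]

theorem conj_rieszSym (j : Fin 3) (ξ : E3) :
    (starRingEnd ℂ) (rieszSym j (-ξ)) = rieszSym j ξ := by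
  simp [rieszSym]

theorem conj_heatDerivSym (α t : ℝ) (j : Fin 3) (ξ : E3) :
    (starRingEnd ℂ) (heatDerivSym α t j (-ξ)) = heatDerivSym α t j ξ := by
  rw [heatDerivSym, map_mul, conj_heatSym, conj_derivSym, heatDerivSym]

theorem conj_conv_neg (a b : E3 → ℂ) (ξ : E3) :
    (starRingEnd ℂ) (conv a b (-ξ)) =
      conv (fun η => (starRingEnd ℂ) (a (-η))) (fun η => (starRingEnd ℂ) (b (-η))) ξ := by
  rw [conv_apply, conv_apply, ← integral_conj, ← integral_neg_eq_self]
  refine integral_congr_ae (Eventually.of_forall fun η => ?_)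
  simp only [map_mul]
  congr 3
  abel

theorem conjNeg_prodHs {s : ℝ} (hs : 3 / 2 < s) (g h : L2C) :
    conjNeg (prodHs hs g h) = prodHs hs (conjNeg g) (conjNeg h) := by
  have hb : ∀ g, (fun η => (starRingEnd ℂ) (bessel s g (-η))) =ᵐ[volume] bessel s (conjNeg g) := by
    intro g
    have e : conjNeg (bessel s g) = bessel s (conjNeg g) := by
      refine conjNeg_mulL (memLp_top_invBracket (by linarith)) (fun ξ => ?_) g
      rw [invBracket, invBracket, Complex.conj_ofReal, bracket, bracket, norm_neg]
    rw [← e]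
    exact (conjNeg_coeFn _).symm
  refine Lp.ext ?_
  filter_upwards [conjNeg_coeFn (prodHs hs g h), ae_comp_neg (prodHs_coeFn hs g h),
    prodHs_coeFn hs (conjNeg g) (conjNeg h)] with ξ h1 h2 h3
  rw [h1, h2, h3, map_mul, conj_conv_neg, conv_congr (hb g) (hb h), Complex.conj_ofReal, bracket,
    bracket, norm_neg]

/-- `conjNeg` in each component. -/
def conjNegV : (Fin 3 → L2C) →L[ℝ] (Fin 3 → L2C) :=
  ContinuousLinearMap.pi fun i => conjNeg.comp (ContinuousLinearMap.proj i)

theorem conjNegV_apply (G : Fin 3 → L2C) (i : Fin 3) : conjNegV G i = conjNeg (G i) := rfl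

theorem conjNegV_linearFlow {α t : ℝ} (hα : 0 ≤ α) (ht : 0 ≤ t) (G₀ : Fin 3 → L2C) :
    conjNegV (linearFlow α G₀ t) = linearFlow α (conjNegV G₀) t :=
  funext fun i => conjNeg_mulL (memLp_heatSym hα ht) (conj_heatSym α t) (G₀ i)

theorem conjNeg_riesz_riesz (i k : Fin 3) (f : L2C) :
    conjNeg (mulL (rieszSym i) (mulL (rieszSym k) f)) =
      mulL (rieszSym i) (mulL (rieszSym k) (conjNeg f)) := by
  rw [conjNeg_mulL (memLp_rieszSym i) (conj_rieszSym i),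
    conjNeg_mulL (memLp_rieszSym k) (conj_rieszSym k)]

theorem conjNegV_duhamelKernel {s α r : ℝ} (hs : 3 / 2 < s) (hα : 1 ≤ α) (hr : 0 < r)
    (G : Fin 3 → L2C) : conjNegV (duhamelKernel α r (tensorSq hs G)) =
      duhamelKernel α r (tensorSq hs (conjNegV G)) := by
  have hk : ∀ k, conjNeg (∑ j, mulL (heatDerivSym α r j) (tensorSq hs G j k)) =
      ∑ j, mulL (heatDerivSym α r j) (tensorSq hs (conjNegV G) j k) := by
    intro k
    rw [map_sum]
    refine Finset.sum_congr rfl fun j _ => ?_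
    rw [conjNeg_mulL (memLp_heatDerivSym hα hr j) (conj_heatDerivSym α r j)]
    exact congrArg _ (conjNeg_prodHs hs (G j) (G k))
  refine funext fun i => ?_
  rw [conjNegV_apply, duhamelKernel_apply, duhamelKernel_apply, lerayL_apply, lerayL_apply,
    map_add, hk, map_sum]
  simp only [conjNeg_riesz_riesz, hk]

/-! ### The pressure -/

/-- The representative of the pressure `∑ᵢⱼ Rᵢ Rⱼ (uᵢ uⱼ)`, if `G` represents `u`. -/
def pressureRep {s : ℝ} (hs : 3 / 2 < s) (G : Fin 3 → L2C) : L2C :=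
  ∑ i, ∑ j, mulL (rieszSym i) (mulL (rieszSym j) (tensorSq hs G i j))

theorem continuous_pressureRep {s : ℝ} (hs : 3 / 2 < s) : Continuous (pressureRep hs) := by
  have hQ : Continuous (tensorSq hs) :=
    continuous_of_locally_lipschitz (norm_tensorSq_sub_le hs)
  refine continuous_finsetSum _ fun i _ => continuous_finsetSum _ fun j _ => ?_
  exact (mulL _).continuous.comp ((mulL _).continuous.comp
    ((continuous_apply j).comp ((continuous_apply i).comp hQ)))

theorem conjNeg_pressureRep {s : ℝ} (hs : 3 / 2 < s) {G : Fin 3 → L2C} (hG : conjNegV G = G) :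
    conjNeg (pressureRep hs G) = pressureRep hs G := by
  simp only [pressureRep, map_sum, conjNeg_riesz_riesz]
  refine Finset.sum_congr rfl fun i _ => Finset.sum_congr rfl fun j _ => ?_
  rw [tensorSq, conjNeg_prodHs, ← conjNegV_apply, ← conjNegV_apply, hG]

theorem sum_riesz_mulL2 {s : ℝ} (hs : 3 / 2 < s) {u : Fin 3 → L2R} {G : Fin 3 → L2C}
    (h : ∀ i, toC (u i) = ofRep s (G i)) :
    ∑ i, ∑ j, riesz i (riesz j (mulL2 (toC (u i)) (toC (u j)))) = ofRep s (pressureRep hs G) := by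
  have hb := memLp_top_invBracket (by linarith : 0 ≤ s)
  rw [eq_ofRep_iff, pressureRep, map_sum, fourier_sum]
  refine Finset.sum_congr rfl fun i _ => ?_
  rw [map_sum, fourier_sum]
  refine Finset.sum_congr rfl fun j _ => ?_
  rw [h, h, mulL2_ofRep hs, fourier_riesz_riesz, fourier_ofRep, bessel,
    mulL_comm (memLp_rieszSym j) hb, mulL_comm (memLp_rieszSym i) hb, tensorSq]

/-! ### The existence time -/

theorem hsNorm_pos {s : ℝ} (hs : 0 ≤ s) {u : Fin 3 → L2R} (hu : ∀ i, MemHs s (u i)) (h0 : u ≠ 0) :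
    0 < hsNorm s u := by
  choose G hG using fun i => exists_eq_ofRep hs (hu i)
  refine lt_of_lt_of_le (norm_pos_iff.mpr fun hz => h0 ?_) (norm_le_hsNorm hs hG)
  refine funext fun i => toC_injective ?_
  rw [hG i, hz, Pi.zero_apply, Pi.zero_apply, map_zero, toC_zero]

theorem existenceTime_pos {C s α : ℝ} (hC : 0 < C) (hα : 1 < α) {u : Fin 3 → L2R}
    (hu : 0 < hsNorm s u) : 0 < existenceTime C s α u := by
  have : 0 < 1 - 1 / α := by rw [sub_pos, div_lt_one (by linarith)]; exact hα
  unfold existenceTime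
  positivity

/-- The existence time meets the smallness condition of `IsSingularKernel.exists_solution`, with the
factor `2^{-(1-1/α)}` to spare. -/
theorem existenceTime_rpow_lt {C s α : ℝ} (hC : 0 < C) (hα : 1 < α) {u : Fin 3 → L2R}
    (hu : 0 < hsNorm s u) :
    4 * C * hsNorm s u * (existenceTime C s α u ^ (1 - 1 / α) / (1 - 1 / α)) < 1 := by
  have hβ : 0 < 1 - 1 / α := by rw [sub_pos, div_lt_one (by linarith)]; exact hα
  set N := hsNorm s u
  set b := (1 - 1 / α) / (4 * C * N) with hb
  have hb0 : 0 < b := by positivity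
  have e : existenceTime C s α u ^ (1 - 1 / α) = (1 / 2) ^ (1 - 1 / α) * b := by
    rw [existenceTime, Real.mul_rpow (by norm_num) (by positivity), ← Real.rpow_mul hb0.le]
    have : α / (α - 1) * (1 - 1 / α) = 1 := by
      have h1 : α - 1 ≠ 0 := by linarith
      have h2 : α ≠ 0 := by linarith
      field_simp
    rw [this, Real.rpow_one]
  have h2 : (1 / 2 : ℝ) ^ (1 - 1 / α) < 1 := Real.rpow_lt_one (by norm_num) (by norm_num) hβ
  have e2 : 4 * C * N * ((1 / 2) ^ (1 - 1 / α) * b / (1 - 1 / α)) = (1 / 2) ^ (1 - 1 / α) := by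
    have h1 : α - 1 ≠ 0 := by linarith
    rw [hb]
    field_simp
  rw [e, e2]
  exact h2

/-- The Volterra equation of the representatives, with real data and small existence time, has a
continuous solution; it consists of real divergence free fields. -/
theorem exists_real_solution {s α T : ℝ} (hs : 3 / 2 < s) (hα : 1 < α) (hT : 0 ≤ T)
    {G₀ : Fin 3 → L2C} (hdiv₀ : divL s G₀ = 0) (hreal : conjNegV G₀ = G₀)
    (hsmall : 4 * (12 * (algConst s ^ (1 / 2 : ℝ)).toReal) * ‖G₀‖ *
      (T ^ (1 - 1 / α) / (1 - 1 / α)) < 1) :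
    ∃ G : ℝ → Fin 3 → L2C, ContinuousOn G (Icc 0 T) ∧
      (∀ t ∈ Icc 0 T, G t = linearFlow α G₀ t -
        ∫ τ in (0 : ℝ)..t, duhamelKernel α (t - τ) (tensorSq hs (G τ))) ∧
      (∀ t ∈ Icc 0 T, divL s (G t) = 0) ∧ ∀ t ∈ Icc 0 T, conjNegV (G t) = G t := by
  have hα0 : 0 ≤ α := by linarith
  have hK := isSingularKernel_duhamelKernel hα
  have hQ : Continuous (tensorSq hs) :=
    continuous_of_locally_lipschitz (norm_tensorSq_sub_le hs)
  obtain ⟨G, hG, hsol⟩ := hK.exists_solution hT ENNReal.toReal_nonneg (norm_nonneg G₀)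
    (norm_tensorSq_sub_le hs) (tensorSq_zero hs) (continuousOn_linearFlow hα0 G₀ T)
    (fun t ht => norm_linearFlow_le hα0 ht.1 G₀) hsmall
  have hint : ∀ t ∈ Icc 0 T, IntervalIntegrable
      (fun τ => duhamelKernel α (t - τ) (tensorSq hs (G τ))) volume 0 t := fun t ht =>
    hK.intervalIntegrable ht.1 ((hQ.comp_continuousOn hG).mono (Icc_subset_Icc_right ht.2))
  refine ⟨G, hG, hsol, fun t ht => ?_, ?_⟩
  · let L : (Fin 3 → L2C) →L[ℝ] L2C := (∑ i, (mulL (besselDerivSym s i)).comp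
      (ContinuousLinearMap.proj (R := ℂ) (φ := fun _ : Fin 3 => L2C) i)).restrictScalars ℝ
    have hL : ∀ F, L F = divL s F := fun F => by simp [L, divL]
    have h1 : divL s (linearFlow α G₀ t) = 0 := by
      have := mulL_divL (by linarith : 1 ≤ s) (memLp_heatSym hα0 ht.1) G₀
      rw [hdiv₀, map_zero] at this
      exact this.symm
    rw [← hL, hsol t ht, map_sub, hL, h1, ← L.intervalIntegral_comp_comm (hint t ht)]
    simp only [hL, divL_duhamelKernel (by linarith : 1 ≤ s), intervalIntegral.integral_zero,
      sub_zero]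
  · -- the conjugate field solves the same equation, hence agrees with `G`
    refine hK.solution_unique (y := linearFlow α G₀) ENNReal.toReal_nonneg
      (norm_tensorSq_sub_le hs) (conjNegV.continuous.comp_continuousOn hG) hG (fun t ht => ?_) hsol
    rw [hsol t ht, map_sub, conjNegV_linearFlow hα0 ht.1, hreal,
      ← conjNegV.intervalIntegral_comp_comm (hint t ht)]
    congr 1
    refine intervalIntegral.integral_congr_ae ?_
    filter_upwards [Measure.ae_ne volume t] with τ hne hτ
    rw [uIoc_of_le ht.1] at hτ
    exact conjNegV_duhamelKernel hs hα.le (sub_pos.mpr (lt_of_le_of_ne hτ.2 hne)) (G τ)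

end FracNS

end

open FracNS
theorem proposition1p1 (s : ℝ) (hs : 3 / 2 < s) :
    ∃ C : ℝ, 0 < C ∧
      ∀ α : ℝ, 1 < α → α ≤ 2 →
      ∀ u₀ : Fin 3 → L2R, (∀ i, MemHs s (u₀ i)) → DivFree u₀ →
        (u₀ ≠ 0 → 0 < existenceTime C s α u₀) ∧
        ∀ T : ℝ, 0 < T → (u₀ ≠ 0 → T = existenceTime C s α u₀) →
          ∃ (u : ℝ → Fin 3 → L2R) (p : ℝ → L2R),
            (∀ i, ContHs s T (fun t => u t i)) ∧
            IsMildSolution α T u₀ u ∧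
            (∀ t ∈ Set.Icc 0 T, DivFree (u t)) ∧
            (∀ t ∈ Set.Icc 0 T, IsPressure (u t) (p t)) ∧
            ContHs s T p ∧
            ∀ v : ℝ → Fin 3 → L2R, (∀ i, ContHs s T (fun t => v t i)) →
              IsMildSolution α T u₀ v → ∀ t ∈ Set.Icc 0 T, v t = u t := by
  have hs0 : 0 ≤ s := by linarith
  have hs1 : 1 ≤ s := by linarith
  set c := (algConst s ^ (1 / 2 : ℝ)).toReal with hc
  have hc0 : 0 ≤ c := ENNReal.toReal_nonneg
  -- `12` bounds the kernel and `c` the nonlinearity; the summand `1` makes the constant positive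
  have hC : 0 < 12 * c + 1 := by linarith
  refine ⟨12 * c + 1, hC, fun α hα _ u₀ hu₀ hdiv₀ => ⟨fun h0 =>
    existenceTime_pos hC hα (hsNorm_pos hs0 hu₀ h0), fun T hT hTe => ?_⟩⟩
  have hα0 : 0 ≤ α := by linarith
  have hK := isSingularKernel_duhamelKernel hα
  choose G₀ hG₀ using fun i => exists_eq_ofRep hs0 (hu₀ i)
  have hdG₀ : divL s G₀ = 0 := (divFree_iff hs1 hG₀).mp hdiv₀
  have hsmall : 4 * (12 * c) * ‖G₀‖ * (T ^ (1 - 1 / α) / (1 - 1 / α)) < 1 := by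
    by_cases h0 : u₀ = 0
    · have hz : G₀ = 0 := funext fun i => ofRep_injective hs0 (by
        rw [← hG₀ i, h0, Pi.zero_apply, toC_zero, Pi.zero_apply, map_zero])
      rw [hz, norm_zero, mul_zero, zero_mul]
      exact one_pos
    · have hβ : 0 < 1 - 1 / α := by rw [sub_pos, div_lt_one (by linarith)]; exact hα
      refine lt_of_le_of_lt ?_ (existenceTime_rpow_lt hC hα (hsNorm_pos hs0 hu₀ h0))
      rw [← hTe h0]
      have := norm_le_hsNorm hs0 hG₀
      gcongr
      linarith
  obtain ⟨G, hG, hsol, hdiv, hreal⟩ := exists_real_solution hs hα hT.le hdG₀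
    (funext fun i => conjNeg_eq_of_toC hs0 (hG₀ i)) hsmall
  have hu : ∀ t ∈ Icc 0 T, ∀ i, toC (reL (ofRep s (G t i))) = ofRep s (G t i) := fun t ht i =>
    toC_reL_ofRep hs0 (congrFun (hreal t ht) i)
  have hp : ∀ t ∈ Icc 0 T, toC (reL (ofRep s (pressureRep hs (G t)))) =
      ofRep s (pressureRep hs (G t)) := fun t ht =>
    toC_reL_ofRep hs0 (conjNeg_pressureRep hs (hreal t ht))
  refine ⟨fun t i => reL (ofRep s (G t i)), fun t => reL (ofRep s (pressureRep hs (G t))),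
    fun i => (contHs_iff hs0 fun t ht => hu t ht i).mpr (continuousOn_pi.mp hG i),
    (isMildSolution_iff hs hα hG₀ hG hu hdiv).mpr hsol,
    fun t ht => (divFree_iff hs1 (hu t ht)).mpr (hdiv t ht),
    fun t ht => (hp t ht).trans (sum_riesz_mulL2 hs (hu t ht)).symm,
    (contHs_iff hs0 hp).mpr ((continuous_pressureRep hs).comp_continuousOn hG), ?_⟩
  intro v hv hvm t ht
  obtain ⟨H, hH, hvH⟩ := exists_rep_of_contHs hs0 hv
  have hdH : ∀ t ∈ Icc 0 T, divL s (H t) = 0 := fun t ht =>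
    divL_eq_zero_of_isMildSolution hs1 hα0 hG₀ hdG₀ hvm ht (hvH t ht)
  have hHG : EqOn H G (Icc 0 T) := hK.solution_unique ENNReal.toReal_nonneg
    (norm_tensorSq_sub_le hs) hH hG ((isMildSolution_iff hs hα hG₀ hH hvH hdH).mp hvm) hsol
  refine funext fun i => toC_injective ?_
  rw [hvH t ht i, hHG ht, hu t ht i]
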